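/- For a finite simple connected graph $G$ and a set $S\subseteq V(G)$, an $S$-tree is a subgraph $T$ of $G$ that is a tree with $S\subseteq V(T)$. Trees $T_1,\dots,T_r$ are internally edge disjoint $S$-trees if each $T_i$ is an $S$-tree and $V(T_i)\cap V(T_j)=S$, $E(T_i)\cap E(T_j)=\emptyset$ for all $i\ne j$. Let $\kappa_G(S)$ be the maximum number of internally edge disjoint $S$-trees in $G$, and, for $2\le k\le |V(G)|$, let $\kappa_k(G)=\min\{\kappa_G(S) : S\subseteq V(G),\ |S|=k\}$ be the generalized $k$-connectivity of $G$. For a permutation $\tau$ of $[n]=\{1,\dots,n\}$ and $2\le i\le n$, let $\tau(1,i)$ denote the permutation obtained from $\tau$ by interchanging its first and its $i$-th entry. For $n\ge 2$, the hierarchical star graph $HS_n$ has as vertices all pairs $x=\langle c(x),p(x)\rangle$ of permutations of $[n]$; two vertices $x$ and $y$ are adjacent if and only if one of the following holds: (1) $c(x)=c(y)$ and $p(x)=p(y)(1,i)$ for some $2\le i\le n$; (2) $c(x)\ne c(y)$, $c(x)=p(x)$ and $c(y)=p(y)=c(x)(1,n)$; (3) $c(x)\ne c(y)$, $c(x)\ne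 p(x)$, $c(x)=p(y)$ and $p(x)=c(y)$. Then, for every integer $n\ge 2$, $\kappa_3(HS_n)=n-1$. -/

import Mathlib

/-- `T` is an `S`-tree of `G`: a subgraph of `G` which is a tree and whose vertex set contains `S`. -/
def IsSTree {V : Type*} {G : SimpleGraph V} (S : Set V) (T : G.Subgraph) : Prop :=
  T.coe.IsTree ∧ S ⊆ T.verts

/-- The family `T` consists of internally edge disjoint `S`-trees: any two of them (at different
indices) share exactly the vertices of `S` and have no common edge. -/
def InternallyEdgeDisjointSTrees {V ι : Type*} {G : SimpleGraph V} (S : Set V)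
    (T : ι → G.Subgraph) : Prop :=
  (∀ i, IsSTree S (T i)) ∧
    ∀ i j, i ≠ j → (T i).verts ∩ (T j).verts = S ∧ (T i).edgeSet ∩ (T j).edgeSet = ∅

/-- `κ_G(S)`: the maximum number of internally edge disjoint `S`-trees in `G`, as the supremum
in `ℕ∞` of all `r` for which there is such a family of `r` trees. -/
noncomputable def localTreeConnectivity {V : Type*} (G : SimpleGraph V) (S : Set V) : ℕ∞ :=
  sSup {m : ℕ∞ | ∃ (r : ℕ) (T : Fin r → G.Subgraph),
    InternallyEdgeDisjointSTrees S T ∧ m = (r : ℕ∞)}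

/-- The generalized `k`-connectivity `κ_k(G)`: the minimum of `κ_G(S)` over all sets `S` of
exactly `k` vertices. It is meant for `2 ≤ k ≤ |V(G)|`. -/
noncomputable def generalizedConnectivity {V : Type*} (k : ℕ) (G : SimpleGraph V) : ℕ∞ :=
  ⨅ S : {S : Finset V // S.card = k}, localTreeConnectivity G (S.1 : Set V)

/-- `u = v(1,i)` for some `2 ≤ i ≤ n`: the word `u(1) u(2) ⋯ u(n)` is obtained from the word of
`v` by interchanging its first entry with another one. Positions are numbered from `0` in
`Fin n`, and interchanging positions is multiplication by a transposition on the right. -/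
def IsStarSwap {n : ℕ} (u v : Equiv.Perm (Fin n)) : Prop :=
  ∃ a i : Fin n, (a : ℕ) = 0 ∧ (i : ℕ) ≠ 0 ∧ u = v * Equiv.swap a i

/-- `u = v(1,n)`: `u` is obtained from `v` by interchanging its first and its last entry. -/
def IsFirstLastSwap {n : ℕ} (u v : Equiv.Perm (Fin n)) : Prop :=
  ∃ a b : Fin n, (a : ℕ) = 0 ∧ (b : ℕ) + 1 = n ∧ u = v * Equiv.swap a b

theorem IsStarSwap.symm {n : ℕ} {u v : Equiv.Perm (Fin n)} (h : IsStarSwap u v) :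
    IsStarSwap v u := by
  obtain ⟨a, i, ha, hi, rfl⟩ := h
  exact ⟨a, i, ha, hi, by simp [mul_assoc]⟩

theorem IsFirstLastSwap.symm {n : ℕ} {u v : Equiv.Perm (Fin n)} (h : IsFirstLastSwap u v) :
    IsFirstLastSwap v u := by
  obtain ⟨a, i, ha, hi, rfl⟩ := h
  exact ⟨a, i, ha, hi, by simp [mul_assoc]⟩

theorem IsStarSwap.ne {n : ℕ} {u v : Equiv.Perm (Fin n)} (h : IsStarSwap u v) : u ≠ v := by
  obtain ⟨a, i, ha, hi, rfl⟩ := h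
  intro h
  have h1 : Equiv.swap a i = 1 := by simpa using h
  have h2 : a = i := Equiv.swap_eq_one_iff.mp h1
  exact hi (h2 ▸ ha)

/-- The hierarchical star graph `HS_n`. A vertex `x = (c(x), p(x))` is a pair of permutations of
`n` symbols: the cluster `c(x) = x.1` and the position `p(x) = x.2` within the cluster. -/
def hierarchicalStarGraph (n : ℕ) :
    SimpleGraph (Equiv.Perm (Fin n) × Equiv.Perm (Fin n)) where
  Adj x y :=
    (x.1 = y.1 ∧ IsStarSwap x.2 y.2) ∨
    (x.1 ≠ y.1 ∧ x.1 = x.2 ∧ y.1 = y.2 ∧ IsFirstLastSwap y.1 x.1) ∨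
    (x.1 ≠ y.1 ∧ x.1 ≠ x.2 ∧ x.1 = y.2 ∧ x.2 = y.1)
  symm := ⟨by
    rintro x y (⟨h, h'⟩ | ⟨h, h1, h2, h3⟩ | ⟨h, h1, h2, h3⟩)
    · exact Or.inl ⟨h.symm, h'.symm⟩
    · exact Or.inr (Or.inl ⟨h.symm, h2, h1, h3.symm⟩)
    · exact Or.inr (Or.inr ⟨h.symm, fun e => h (h2.trans e.symm), h3.symm, h2.symm⟩)⟩
  loopless := ⟨by
    rintro x (⟨-, h⟩ | ⟨h, -⟩ | ⟨h, -⟩)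
    · exact h.ne rfl
    · exact h rfl
    · exact h rfl⟩

/-! Write n = k + 1. A cluster is a copy of the star graph on k + 1 symbols, which is k-regular,
k-connected and has no triangles or quadrangles. Each vertex (c, p) has one further neighbour
outside its cluster, namely (p, c) if p ≠ c. So any two clusters c ≠ d are joined by the edge (c,
d)(d, c).

Upper bound: all degrees are at most k + 1, and each tree uses an edge at every vertex of S. If S
contains adjacent vertices x, y, then k + 1 trees would have exactly one edge each at x and at y,
and the tree containing xy could not reach the third vertex
(`InternallyEdgeDisjointSTrees.lt_of_adj`).

Lower bound: k trees are built according to how S meets the clusters. With three clusters, k unused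
clusters serve as centres, reached by fans inside the three clusters. With two clusters, the i-th
tree runs through the i-th neighbour of the first vertex p, which is also linked to the second
vertex q of that cluster by a stem avoiding p; it leaves the cluster there and ends in a fan at the
third vertex. The fans come from Menger's theorem and `permStarGraph_isWellConnected`. With one
cluster c, the permutations are coloured with k colours, and the i-th tree uses the clusters and the
vertices of c of colour i. Each vertex of S then only has to see every colour nearby, which is a
counting matter because neighbourhoods overlap in at most one vertex (`hasRainbowColoring`). -/

/-! ### Separations, linkages and Menger's theorem -/

namespace SimpleGraph

variable {V : Type*}

/-- The subgraph of `G` formed by the edges with both ends in `C`, on the same vertex type. -/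
def within (G : SimpleGraph V) (C : Set V) : SimpleGraph V where
  Adj a b := G.Adj a b ∧ a ∈ C ∧ b ∈ C
  symm := ⟨fun _ _ h => ⟨h.1.symm, h.2.2, h.2.1⟩⟩
  loopless := ⟨fun _ h => h.1.ne rfl⟩

/-- Any two vertices of `C` are joined by a walk of `G` inside `C`. -/
def JoinedOn (G : SimpleGraph V) (C : Set V) : Prop :=
  ∀ u ∈ C, ∀ v ∈ C, (G.within C).Reachable u v

theorem within_mono {G H : SimpleGraph V} (h : G ≤ H) {C D : Set V} (hCD : C ⊆ D) :
    G.within C ≤ H.within D :=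
  fun _ _ hab => ⟨h hab.1, hCD hab.2.1, hCD hab.2.2⟩

theorem JoinedOn.mono {G H : SimpleGraph V} (h : G ≤ H) {C : Set V} (hC : G.JoinedOn C) :
    H.JoinedOn C :=
  fun u hu v hv => (hC u hu v hv).mono (within_mono h subset_rfl)

theorem joinedOn_singleton (G : SimpleGraph V) (v : V) : G.JoinedOn {v} := by
  rintro u rfl w rfl
  exact Reachable.refl _

theorem JoinedOn.of_base {G : SimpleGraph V} {C : Set V} (b : V)
    (h : ∀ u ∈ C, (G.within C).Reachable u b) : G.JoinedOn C :=
  fun u hu v hv => (h u hu).trans (h v hv).symm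

theorem JoinedOn.union_of_adj {G : SimpleGraph V} {C D : Set V} (hC : G.JoinedOn C)
    (hD : G.JoinedOn D) {a b : V} (ha : a ∈ C) (hb : b ∈ D) (hab : a = b ∨ G.Adj a b) :
    G.JoinedOn (C ∪ D) := by
  have key : (G.within (C ∪ D)).Reachable a b := by
    rcases hab with rfl | h
    · exact Reachable.refl _
    · exact Adj.reachable ⟨h, Or.inl ha, Or.inr hb⟩
  refine JoinedOn.of_base b ?_
  rintro u (hu | hu)
  · exact ((hC u hu a ha).mono (within_mono le_rfl Set.subset_union_left)).trans key
  · exact (hD u hu b hb).mono (within_mono le_rfl Set.subset_union_right)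

/-- A nontrivial joined set has an edge at each of its vertices. -/
theorem JoinedOn.exists_adj {G : SimpleGraph V} {C : Set V} (hC : G.JoinedOn C) {u v : V}
    (hu : u ∈ C) (hv : v ∈ C) (huv : u ≠ v) : ∃ w ∈ C, G.Adj u w := by
  obtain ⟨p⟩ := hC u hu v hv
  cases p with
  | nil => exact absurd rfl huv
  | cons h _ => exact ⟨_, h.2.2, h.1⟩

/-- `(L, R)` is a separation of `G`: the two sides cover the vertices and no edge joins
`L \ R` to `R \ L`. -/
def IsSeparation (G : SimpleGraph V) (L R : Set V) : Prop :=
  L ∪ R = Set.univ ∧ ∀ u v, u ∈ L → u ∉ R → v ∈ R → v ∉ L → ¬ G.Adj u v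

theorem IsSeparation.symm {G : SimpleGraph V} {L R : Set V} (h : G.IsSeparation L R) :
    G.IsSeparation R L :=
  ⟨by rw [Set.union_comm]; exact h.1, fun u v h1 h2 h3 h4 huv => h.2 v u h3 h4 h1 h2 huv.symm⟩

/-- A family of `k` pairwise disjoint joined sets, the `i`-th one linking `a i` to `b i`. -/
structure IsLinkage (G : SimpleGraph V) {k : ℕ} (a b : Fin k → V) (C : Fin k → Set V) : Prop where
  joined : ∀ i, G.JoinedOn (C i)
  source : ∀ i, a i ∈ C i
  target : ∀ i, b i ∈ C i
  disjoint : ∀ i j v, v ∈ C i → v ∈ C j → i = j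

theorem IsLinkage.symm {G : SimpleGraph V} {k : ℕ} {a b : Fin k → V} {C : Fin k → Set V}
    (h : G.IsLinkage a b C) : G.IsLinkage b a C :=
  ⟨h.joined, h.target, h.source, h.disjoint⟩

theorem IsLinkage.mono {G H : SimpleGraph V} (hle : G ≤ H) {k : ℕ} {a b : Fin k → V}
    {C : Fin k → Set V} (h : G.IsLinkage a b C) : H.IsLinkage a b C :=
  ⟨fun i => (h.joined i).mono hle, h.source, h.target, h.disjoint⟩

theorem IsLinkage.injective_target {G : SimpleGraph V} {k : ℕ} {a b : Fin k → V}
    {C : Fin k → Set V} (h : G.IsLinkage a b C) : Function.Injective b :=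
  fun i j hij => h.disjoint i j (b i) (h.target i) (hij ▸ h.target j)

/-- If `b` takes values in a set `P` of at most `k` elements, it enumerates `P`. -/
theorem IsLinkage.exists_target {G : SimpleGraph V} {k : ℕ} {a b : Fin k → V}
    {C : Fin k → Set V} (h : G.IsLinkage a b C) [Finite V] {P : Set V} (hP : P.ncard ≤ k)
    (hb : ∀ i, b i ∈ P) {v : V} (hvP : v ∈ P) : ∃ i, b i = v := by
  have hr : Set.range b = P := by
    apply Set.eq_of_subset_of_ncard_le
    · rintro _ ⟨i, rfl⟩; exact hb i
    · rw [← Set.image_univ, Set.ncard_image_of_injective _ h.injective_target, Set.ncard_univ]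
      simpa using hP
    · exact Set.toFinite _
  rw [← hr] at hvP
  exact hvP

/-- The ends exhaust `P`, so any vertex of `P` is already the end of some member, and disjointness
keeps it out of all others. This controls where two linkages can meet when they are glued. -/
theorem IsLinkage.eq_target {G : SimpleGraph V} {k : ℕ} {a b : Fin k → V}
    {C : Fin k → Set V} (h : G.IsLinkage a b C) [Finite V] {P : Set V} (hP : P.ncard ≤ k)
    (hb : ∀ i, b i ∈ P) {i : Fin k} {v : V} (hv : v ∈ C i) (hvP : v ∈ P) : v = b i := by
  obtain ⟨j, rfl⟩ := h.exists_target hP hb hvP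
  rw [h.disjoint i j _ hv (h.target j)]

/-- Sets of a linkage in a graph all of whose edges lie in `L`, with ends in `L`, lie in `L`. -/
theorem IsLinkage.subset_of_within {G : SimpleGraph V} {k : ℕ} {a b : Fin k → V} {L : Set V}
    {C : Fin k → Set V} (h : (G.within L).IsLinkage a b C) (hb : ∀ i, b i ∈ L) (i : Fin k) :
    C i ⊆ L := by
  intro v hv
  by_cases hvb : v = b i
  · exact hvb ▸ hb i
  · obtain ⟨w, -, hw⟩ := (h.joined i).exists_adj hv (h.target i) hvb
    exact hw.2.1

/-- Gluing two linkages along a separation and one edge `xy` crossing it. -/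
theorem IsLinkage.glue [Finite V] {G : SimpleGraph V} {k : ℕ} {L R : Set V} {x y : V}
    (hxy : G.Adj x y) (hyL : y ∉ L)
    (hP : (insert x (L ∩ R)).ncard ≤ k) (hQ : (insert y (L ∩ R)).ncard ≤ k)
    {a p q b : Fin k → V} {C D : Fin k → Set V}
    (hC : G.IsLinkage a p C) (hD : G.IsLinkage q b D) (hCL : ∀ i, C i ⊆ L) (hDR : ∀ i, D i ⊆ R)
    (hp : ∀ i, p i ∈ insert x (L ∩ R)) (hq : ∀ i, q i ∈ insert y (L ∩ R)) :
    ∃ (σ : Fin k → Fin k) (E : Fin k → Set V), G.IsLinkage a (fun i => b (σ i)) E := by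
  have hex : ∀ i, ∃ j, (p i = x ∧ q j = y) ∨ (p i ∈ L ∩ R ∧ q j = p i) := by
    intro i
    rcases hp i with h | h
    · obtain ⟨j, hj⟩ := hD.symm.exists_target hQ hq (Set.mem_insert y _)
      exact ⟨j, Or.inl ⟨h, hj⟩⟩
    · obtain ⟨j, hj⟩ := hD.symm.exists_target hQ hq (Set.mem_insert_of_mem y h)
      exact ⟨j, Or.inr ⟨h, hj⟩⟩
  choose σ hσ using hex
  have hσinj : ∀ i j, σ i = σ j → i = j := by
    intro i j hij
    apply hC.injective_target
    rcases hσ i with h1 | h1 <;> rcases hσ j with h2 | h2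
    · rw [h1.1, h2.1]
    · exfalso; apply hyL; rw [← h1.2, hij, h2.2]; exact h2.1.1
    · exfalso; apply hyL; rw [← h2.2, ← hij, h1.2]; exact h1.1.1
    · rw [← h1.2, hij, h2.2]
  -- A common vertex lies in `L ∩ R`, hence is the end of its set on either side, and `σ` matches
  -- equal ends.
  have hcross : ∀ i j v, v ∈ C i → v ∈ D (σ j) → i = j := by
    intro i j v h1 h2
    have hvS : v ∈ L ∩ R := ⟨hCL i h1, hDR _ h2⟩
    have e1 := hC.eq_target hP hp h1 (Set.mem_insert_of_mem x hvS)
    have e2 := hD.symm.eq_target hQ hq h2 (Set.mem_insert_of_mem y hvS)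
    apply hC.injective_target
    rcases hσ j with h | h
    · exfalso; apply hyL; rw [← h.2, ← e2]; exact hvS.1
    · rw [← e1, ← h.2, ← e2]
  refine ⟨σ, fun i => C i ∪ D (σ i), ?_, fun i => Or.inl (hC.source i),
    fun i => Or.inr (hD.target _), ?_⟩
  · intro i
    refine (hC.joined i).union_of_adj (hD.joined _) (hC.target i) (hD.source _) ?_
    rcases hσ i with h | h
    · right; rw [h.1, h.2]; exact hxy
    · left; exact h.2.symm
  · rintro i j v (h1 | h1) (h2 | h2)
    · exact hC.disjoint i j v h1 h2
    · exact hcross i j v h1 h2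
    · exact (hcross j i v h2 h1).symm
    · exact hσinj i j (hD.disjoint _ _ v h1 h2)

/-- Restricting to the `L`-side of a separation of order `< k` crossed by the only edge `xy`. -/
theorem le_ncard_of_separation_side [Finite V] {G G' : SimpleGraph V} {k : ℕ} {A B L R : Set V}
    {x y : V} (hG : ∀ L R, G.IsSeparation L R → A ⊆ L → B ⊆ R → k ≤ (L ∩ R).ncard)
    (hG' : ∀ u v, G.Adj u v → G'.Adj u v ∨ s(u, v) = s(x, y))
    (hLR : G'.IsSeparation L R) (hAL : A ⊆ L) (hBR : B ⊆ R) (hyL : y ∉ L)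
    {L' R' : Set V} (hs : (G'.within L).IsSeparation L' R') (hA : A ⊆ L')
    (hB : insert x (L ∩ R) ⊆ R') : k ≤ (L' ∩ R').ncard := by
  -- This pair separates `A` from `B` already in `G`: the edge `xy` cannot cross it, as `x ∈ R'` and
  -- `y ∉ L`. Its order is at most that of `(L', R')` because `L ∩ R ⊆ R'`.
  refine (hG (L' ∩ L) (R' ∪ R) ⟨?_, ?_⟩ (Set.subset_inter hA hAL)
    (hBR.trans Set.subset_union_right)).trans (Set.ncard_le_ncard ?_ (Set.toFinite _))
  · ext v
    have h1 : v ∈ L ∪ R := hLR.1 ▸ Set.mem_univ v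
    have h2 : v ∈ L' ∪ R' := hs.1 ▸ Set.mem_univ v
    simp only [Set.mem_union, Set.mem_inter_iff, Set.mem_univ, iff_true] at *
    tauto
  · rintro u v ⟨huL', huL⟩ hu hv hv' huv
    have huR' : u ∉ R' := fun h => hu (Or.inl h)
    have huR : u ∉ R := fun h => hu (Or.inr h)
    have hux : u ≠ x := fun h => huR' (hB (by rw [h]; exact Set.mem_insert x _))
    have huy : u ≠ y := fun h => hyL (h ▸ huL)
    have hadj : G'.Adj u v := by
      rcases hG' u v huv with h | h
      · exact h
      · exfalso
        rcases Sym2.eq_iff.mp h with h | h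
        · exact hux h.1
        · exact huy h.1
    have hvL : v ∈ L := by
      by_contra hvL
      have : v ∈ L ∪ R := hLR.1 ▸ Set.mem_univ v
      exact hLR.2 u v huL huR (this.resolve_left hvL) hvL hadj
    have hvL' : v ∉ L' := fun h => hv' ⟨h, hvL⟩
    have hvR' : v ∈ R' := by
      have : v ∈ L' ∪ R' := hs.1 ▸ Set.mem_univ v
      exact this.resolve_left hvL'
    exact hs.2 u v huL' huR' hvR' hvL' ⟨hadj, huL, hvL⟩
  · rintro v ⟨⟨h1, h2⟩, h3 | h3⟩
    · exact ⟨h1, h3⟩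
    · exact ⟨h1, hB (Set.mem_insert_of_mem x ⟨h2, h3⟩)⟩

/-- **Menger's theorem**, set version: if no separation of order less than `k` has `A` on its left
and `B` on its right, there are `k` pairwise disjoint joined sets linking `A` to `B`. -/
theorem exists_linkage [Finite V] (G : SimpleGraph V) (k : ℕ) (A B : Set V)
    (hG : ∀ L R, G.IsSeparation L R → A ⊆ L → B ⊆ R → k ≤ (L ∩ R).ncard) :
    ∃ (a b : Fin k → V) (C : Fin k → Set V), G.IsLinkage a b C ∧ (∀ i, a i ∈ A) ∧ ∀ i, b i ∈ B := by
  induction G using WellFoundedLT.induction generalizing A B with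
  | ind G ih =>
  by_cases hbot : ∀ u v, ¬ G.Adj u v
  -- Without edges every cover is a separation. This one has order `|A ∩ B|`, so single vertices
  -- form the linkage.
  · have h1 := hG A (B ∪ Aᶜ) ⟨by ext v; simp; tauto, fun u v _ _ _ _ => hbot u v⟩ subset_rfl
      Set.subset_union_left
    have h2 : A ∩ (B ∪ Aᶜ) = A ∩ B := by ext v; simp; tauto
    rw [h2] at h1
    obtain ⟨t, ht, htk⟩ := Set.exists_subset_card_eq h1
    have : Nat.card t = k := htk
    let e : Fin k ≃ t := (Finite.equivFinOfCardEq this).symm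
    refine ⟨fun i => e i, fun i => e i, fun i => {(e i : V)},
      ⟨fun i => joinedOn_singleton _ _, fun i => rfl, fun i => rfl, ?_⟩,
      fun i => (ht (e i).2).1, fun i => (ht (e i).2).2⟩
    rintro i j v rfl h
    exact e.injective (Subtype.ext h)
  · push Not at hbot
    obtain ⟨x₀, y₀, h₀⟩ := hbot
    set G' := G.deleteEdges {s(x₀, y₀)} with hG'def
    have hlt : G' < G := by
      refine lt_of_le_of_ne (deleteEdges_le _) fun h => ?_
      have : G'.Adj x₀ y₀ := h ▸ h₀
      simp [hG'def] at this
    have hdel : ∀ u v, G.Adj u v → G'.Adj u v ∨ s(u, v) = s(x₀, y₀) := by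
      intro u v huv
      simp only [hG'def, deleteEdges_adj, Set.mem_singleton_iff]
      tauto
    by_cases hsep : ∀ L R, G'.IsSeparation L R → A ⊆ L → B ⊆ R → k ≤ (L ∩ R).ncard
    · obtain ⟨a, b, C, hC, h⟩ := ih G' hlt A B hsep
      exact ⟨a, b, C, hC.mono hlt.le, h⟩
    · push Not at hsep
      obtain ⟨L, R, hLR, hAL, hBR, hcard⟩ := hsep
      -- The separation is too small for `G`, so the deleted edge must cross it.
      obtain ⟨x, y, hxy, hxyeq, hxL, hxR, hyR, hyL⟩ : ∃ x y, G.Adj x y ∧ s(x, y) = s(x₀, y₀) ∧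
          x ∈ L ∧ x ∉ R ∧ y ∈ R ∧ y ∉ L := by
        by_contra hno
        push Not at hno
        refine absurd (hG L R ⟨hLR.1, fun u v h1 h2 h3 h4 huv => ?_⟩ hAL hBR) (not_le.mpr hcard)
        rcases hdel u v huv with h | h
        · exact hLR.2 u v h1 h2 h3 h4 h
        · exact h4 (hno u v huv h h1 h2 h3)
      rw [← hxyeq] at hdel
      have hP : (insert x (L ∩ R)).ncard ≤ k := (Set.ncard_insert_le _ _).trans hcard
      have hQ : (insert y (L ∩ R)).ncard ≤ k := (Set.ncard_insert_le _ _).trans hcard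
      have hlt' : ∀ D, G'.within D < G := fun D =>
        lt_of_le_of_lt (fun u v h => h.1) hlt
      -- Each side is linked to `L ∩ R` plus its own end of the deleted edge. These target sets have
      -- at most `k` elements, so both linkages use all of them and fit together.
      obtain ⟨a, p, C, hC, ha, hp⟩ := ih (G'.within L) (hlt' L) A (insert x (L ∩ R))
        (fun L' R' hs hA hB => le_ncard_of_separation_side hG hdel hLR hAL hBR hyL hs hA hB)
      obtain ⟨b, q, D, hD, hb, hq⟩ := ih (G'.within R) (hlt' R) B (insert y (R ∩ L))
        (fun L' R' hs hA hB => le_ncard_of_separation_side (x := y) (y := x)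
          (fun L R hs hB hA => by rw [Set.inter_comm]; exact hG R L hs.symm hA hB)
          (fun u v huv => by rw [Sym2.eq_swap (a := y)]; exact hdel u v huv)
          hLR.symm hBR hAL hxR hs hA hB)
      rw [Set.inter_comm R L] at hq
      have hCL := hC.subset_of_within (fun i => by
        rcases hp i with h | h
        · exact h ▸ hxL
        · exact h.1)
      have hDR := hD.subset_of_within (fun i => by
        rcases hq i with h | h
        · exact h ▸ hyR
        · exact h.2)
      obtain ⟨σ, E, hE⟩ := IsLinkage.glue hxy hyL hP hQ (hC.mono (hlt' L).le)
        (hD.mono (hlt' R).le).symm hCL hDR hp hq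
      exact ⟨a, _, E, hE, ha, fun i => hb _⟩

end SimpleGraph

/-! ### Well-connected graphs and fans -/

namespace SimpleGraph

variable {V : Type*}

/-- No separation of order less than `k` has both sides proper. -/
def IsWellConnected (G : SimpleGraph V) (k : ℕ) : Prop :=
  ∀ L R, G.IsSeparation L R → (L ∩ R).ncard < k → L ⊆ R ∨ R ⊆ L

theorem IsWellConnected.reachable {G : SimpleGraph V} {k : ℕ} (h : G.IsWellConnected k)
    (hk : 0 < k) (u v : V) : G.Reachable u v := by
  have hdisj : ({w | G.Reachable u w} ∩ {w | ¬ G.Reachable u w} : Set V) = ∅ := by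
    ext w; simp
  rcases h {w | G.Reachable u w} {w | ¬ G.Reachable u w}
    ⟨by ext w; simp [em], fun a b ha _ hb _ hab => hb (ha.trans hab.reachable)⟩
    (by rw [hdisj]; simpa using hk) with h | h
  · exact absurd (Reachable.refl u) (h (Reachable.refl u))
  · by_contra hv
    exact hv (h hv)

/-- `C` leads from a neighbour of `p` to `t`, avoiding `p`; it is empty if `t = p`. -/
def IsStem (G : SimpleGraph V) (p t : V) (C : Set V) : Prop :=
  p ∉ C ∧ ((t = p ∧ C = ∅) ∨ (t ∈ C ∧ G.JoinedOn C ∧ ∃ q ∈ C, G.Adj p q))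

/-- Since `T` has at most `m` elements, each of them is an end of the linkage, and the set ending at
`t i` is a stem. An index with `t i = p` takes the empty stem. -/
theorem IsLinkage.exists_stems [Finite V] {G : SimpleGraph V} {U T : Set V} {m : ℕ}
    {a b : Fin m → V} {C : Fin m → Set V} (h : (G.within U).IsLinkage a b C) {p : V}
    (hpU : p ∉ U) (hTU : T ⊆ U) (hT : T.ncard ≤ m) (hb : ∀ i, b i ∈ T) (ha : ∀ i, G.Adj p (a i))
    {ι : Type*} {t : ι → V} (ht : Function.Injective t) (htT : ∀ i, t i ≠ p → t i ∈ T) :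
    ∃ D : ι → Set V, (∀ i, G.IsStem p (t i) (D i)) ∧ (∀ i, D i ⊆ U) ∧
      ∀ i j v, v ∈ D i → v ∈ D j → i = j := by
  have key : ∀ i, ∃ D : Set V, G.IsStem p (t i) D ∧ D ⊆ U ∧
      (D = ∅ ∨ ∃ j, b j = t i ∧ D = C j) := by
    intro i
    by_cases hi : t i = p
    · exact ⟨∅, ⟨by simp, Or.inl ⟨hi, rfl⟩⟩, Set.empty_subset _, Or.inl rfl⟩
    · obtain ⟨j, hj⟩ := h.exists_target hT hb (htT i hi)
      have hCU : C j ⊆ U := h.subset_of_within (fun i => hTU (hb i)) j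
      refine ⟨C j, ⟨fun hp => hpU (hCU hp), Or.inr ⟨hj ▸ h.target j, ?_, a j, h.source j, ha j⟩⟩,
        hCU, Or.inr ⟨j, hj, rfl⟩⟩
      exact (h.joined j).mono (fun u v huv => huv.1 : G.within U ≤ G)
  choose D hD hDU hDC using key
  refine ⟨D, hD, hDU, fun i j v hi hj => ?_⟩
  rcases hDC i with h1 | ⟨i', hi', h1⟩
  · simp [h1] at hi
  rcases hDC j with h2 | ⟨j', hj', h2⟩
  · simp [h2] at hj
  rw [h1] at hi
  rw [h2] at hj
  apply ht
  rw [← hi', ← hj', h.disjoint _ _ v hi hj]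

/-- **Fan lemma**: disjoint stems from `p` to any `k` vertices of a well-connected graph. -/
theorem IsWellConnected.exists_fan [Finite V] {G : SimpleGraph V} {k : ℕ}
    (h : G.IsWellConnected k) (p : V) {t : Fin k → V} (ht : Function.Injective t) :
    ∃ D : Fin k → Set V, (∀ i, G.IsStem p (t i) (D i)) ∧
      ∀ i j v, v ∈ D i → v ∈ D j → i = j := by
  have hTk : (Set.range t \ {p}).ncard ≤ k := by
    refine (Set.ncard_le_ncard Set.sdiff_subset (Set.toFinite _)).trans ?_
    rw [← Set.image_univ, Set.ncard_image_of_injective _ ht, Set.ncard_univ]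
    simp
  obtain ⟨a, b, C, hC, ha, hb⟩ := exists_linkage (G.within {p}ᶜ) (Set.range t \ {p}).ncard
    {v | G.Adj p v} (Set.range t \ {p}) (by
      intro L R hs hA hB
      by_contra hlt
      push Not at hlt
      -- All other ends of edges at `p` lie in `L`, so `p` can join the left side and leave the
      -- right one without raising the order.
      have hsep : G.IsSeparation (insert p L) (R \ {p}) := by
        refine ⟨?_, ?_⟩
        · ext v
          have : v ∈ L ∪ R := hs.1 ▸ Set.mem_univ v
          by_cases hv : v = p
          · simp [hv]
          · simpa [hv] using this
        · rintro u v hu hu' ⟨hv, hvp⟩ hv' huv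
          have hvL : v ∉ L := fun h => hv' (Or.inr h)
          rcases hu with rfl | hu
          · exact hvL (hA huv)
          · by_cases hup : u = p
            · exact hvL (hA (hup ▸ huv))
            · exact hs.2 u v hu (fun h => hu' ⟨h, hup⟩) hv hvL ⟨huv, hup, hvp⟩
      have hsub : insert p L ∩ (R \ {p}) ⊆ L ∩ R := by
        rintro v ⟨h1 | h1, h2, h3⟩
        · exact absurd h1 h3
        · exact ⟨h1, h2⟩
      have hord := (Set.ncard_le_ncard hsub (Set.toFinite _)).trans_lt hlt
      rcases h _ _ hsep (hord.trans_le hTk) with h1 | h1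
      · exact (h1 (Set.mem_insert p L)).2 rfl
      · refine absurd hlt (not_lt.mpr (Set.ncard_le_ncard ?_ (Set.toFinite _)))
        rintro v ⟨hv, hvp⟩
        have hvR := hB ⟨hv, hvp⟩
        exact ⟨(h1 ⟨hvR, hvp⟩).resolve_left hvp, hvR⟩)
  obtain ⟨D, hD, -, hdisj⟩ := hC.exists_stems (p := p) (by simp) (by
    rintro v ⟨-, hv⟩; exact hv) le_rfl hb ha ht (fun i hi => ⟨⟨i, rfl⟩, hi⟩)
  exact ⟨D, hD, hdisj⟩

/-- In a well-connected graph of degree `k`, there are disjoint stems from `y` to the `k`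
neighbours of `x` which avoid `x`. -/
theorem IsWellConnected.exists_fan_neighbors [Finite V] {G : SimpleGraph V} {k : ℕ}
    (h : G.IsWellConnected k) (hreg : ∀ v, {w | G.Adj v w}.ncard = k) {x y : V} (hxy : x ≠ y)
    {t : Fin k → V} (ht : Function.Injective t) (htx : ∀ v, G.Adj x v ↔ v ∈ Set.range t) :
    ∃ D : Fin k → Set V, (∀ i, G.IsStem y (t i) (D i)) ∧ (∀ i, x ∉ D i) ∧
      ∀ i j v, v ∈ D i → v ∈ D j → i = j := by
  -- By regularity the sources and the targets of the linkage are equally many, so a small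
  -- separation can contain neither of them in `L ∩ R`.
  have hTA : (Set.range t \ {y}).ncard = ({v | G.Adj y v} \ {x}).ncard := by
    have : Set.range t = {v | G.Adj x v} := by ext v; rw [← htx]; rfl
    rw [this]
    by_cases hadj : G.Adj x y
    · rw [Set.ncard_sdiff_singleton_of_mem (s := {v | G.Adj x v}) hadj,
        Set.ncard_sdiff_singleton_of_mem (s := {v | G.Adj y v}) hadj.symm, hreg, hreg]
    · rw [Set.sdiff_singleton_eq_self (s := {v | G.Adj x v}) hadj,
        Set.sdiff_singleton_eq_self (s := {v | G.Adj y v}) (fun h => hadj h.symm), hreg, hreg]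
  have hTk : (Set.range t \ {y}).ncard ≤ k := by
    rw [hTA]
    exact (Set.ncard_le_ncard Set.sdiff_subset (Set.toFinite _)).trans (hreg y).le
  obtain ⟨a, b, C, hC, ha, hb⟩ := exists_linkage (G.within {x, y}ᶜ) (Set.range t \ {y}).ncard
    ({v | G.Adj y v} \ {x}) (Set.range t \ {y}) (by
      intro L R hs hA hB
      by_contra hlt
      push Not at hlt
      have hcov : ∀ v, v ∈ L ∪ R := fun v => hs.1 ▸ Set.mem_univ v
      have hadjL : ∀ v, G.Adj y v → v ≠ x → v ∈ L := fun v h1 h2 => hA ⟨h1, h2⟩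
      have hadjR : ∀ v, G.Adj x v → v ≠ y → v ∈ R := fun v h1 h2 => hB ⟨(htx v).mp h1, h2⟩
      have hedge : ∀ u v, u ∈ L → u ∉ R → v ∈ R → v ∉ L → u ≠ x → u ≠ y → v ≠ x → v ≠ y →
          ¬ G.Adj u v := fun u v h1 h2 h3 h4 h5 h6 h7 h8 huv =>
        hs.2 u v h1 h2 h3 h4 ⟨huv, by simp [h5, h6], by simp [h7, h8]⟩
      by_cases hadj : G.Adj x y
      -- The edge `xy` forces one end into both sides, which costs one vertex. Here only `k - 1`
      -- targets are to be linked, so the order is still below `k`.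
      · have hsep : G.IsSeparation (insert y L \ {x}) (insert x (insert y R)) := by
          refine ⟨?_, ?_⟩
          · ext v
            have := hcov v
            simp only [Set.mem_union, Set.mem_sdiff, Set.mem_insert_iff, Set.mem_singleton_iff,
              Set.mem_univ, iff_true] at this ⊢
            tauto
          · rintro u v ⟨hu, hux⟩ hu' hv hv' huv
            simp only [Set.mem_insert_iff, Set.mem_sdiff, Set.mem_singleton_iff,
              not_or, not_and, not_not] at hu hu' hux hv hv'
            obtain ⟨-, huy, huR⟩ := hu'
            have huL := hu.resolve_left huy
            by_cases hvx : v = x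
            · exact huR (hadjR u (hvx ▸ huv.symm) huy)
            · have hvy : v ≠ y := fun h => hvx (hv' (Or.inl h))
              have hvL : v ∉ L := fun h => hvx (hv' (Or.inr h))
              exact hedge u v huL huR ((hv.resolve_left hvx).resolve_left hvy) hvL hux huy hvx
                hvy huv
        have hsub : (insert y L \ {x}) ∩ insert x (insert y R) ⊆ insert y (L ∩ R) := by
          rintro v ⟨⟨h1, h2⟩, h3⟩
          simp only [Set.mem_insert_iff, Set.mem_singleton_iff, Set.mem_inter_iff] at *
          tauto
        have hord : ((insert y L \ {x}) ∩ insert x (insert y R)).ncard < k := by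
          have h1 := Set.ncard_le_ncard hsub (Set.toFinite _)
          have h2 := Set.ncard_insert_le y (L ∩ R)
          have h3 : (Set.range t \ {y}).ncard + 1 = k := by
            rw [hTA, ← hreg y]
            exact Set.ncard_sdiff_singleton_add_one hadj.symm (Set.toFinite _)
          omega
        rcases h _ _ hsep hord with h1 | h1
        · refine absurd hlt (not_lt.mpr (hTA ▸ Set.ncard_le_ncard ?_ (Set.toFinite _)))
          rintro v ⟨hv, hvx⟩
          have hvL := hA ⟨hv, hvx⟩
          refine ⟨hvL, ?_⟩
          exact ((h1 ⟨Or.inr hvL, hvx⟩).resolve_left hvx).resolve_left (G.ne_of_adj hv).symm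
        · exact (h1 (Set.mem_insert x _)).2 rfl
      -- Nonadjacent `y` and `x` can be put strictly on opposite sides at no cost, so neither side
      -- contains the other.
      · have hsep : G.IsSeparation (insert y L \ {x}) (insert x R \ {y}) := by
          refine ⟨?_, ?_⟩
          · ext v
            have := hcov v
            simp only [Set.mem_union, Set.mem_sdiff, Set.mem_insert_iff, Set.mem_singleton_iff,
              Set.mem_univ, iff_true] at this ⊢
            by_cases hvx : v = x
            · simp [hvx, hxy]
            · tauto
          · rintro u v ⟨hu, hux⟩ hu' ⟨hv, hvy⟩ hv' huv
            simp only [Set.mem_insert_iff, Set.mem_sdiff, Set.mem_singleton_iff,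
              not_and, not_not] at hu hu' hux hv hv' hvy
            by_cases huy : u = y
            · have hvx : v ≠ x := fun h => hadj (by rw [← h, ← huy]; exact huv.symm)
              exact hvx (hv' (Or.inr (hadjL v (huy ▸ huv) hvx)))
            · by_cases hvx : v = x
              · exact huy (hu' (Or.inr (hadjR u (hvx ▸ huv.symm) huy)))
              · exact hedge u v (hu.resolve_left huy) (fun h => huy (hu' (Or.inr h)))
                  (hv.resolve_left hvx) (fun h => hvx (hv' (Or.inr h))) hux huy hvx hvy huv
        have hsub : (insert y L \ {x}) ∩ (insert x R \ {y}) ⊆ L ∩ R := by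
          rintro v ⟨⟨h1, h2⟩, h3, h4⟩
          exact ⟨h1.resolve_left h4, h3.resolve_left h2⟩
        have hord := ((Set.ncard_le_ncard hsub (Set.toFinite _)).trans_lt hlt).trans_le hTk
        rcases h _ _ hsep hord with h1 | h1
        · exact (h1 ⟨Set.mem_insert y L, hxy.symm⟩).2 rfl
        · exact (h1 ⟨Set.mem_insert x R, hxy⟩).2 rfl)
  obtain ⟨D, hD, hDU, hdisj⟩ := hC.exists_stems (p := y) (by simp) (by
    rintro v ⟨hv, hvy⟩
    have hvx : v ≠ x := fun e => G.ne_of_adj ((htx v).mpr hv) e.symm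
    simp only [Set.mem_singleton_iff] at hvy
    simp [hvx, hvy]) le_rfl hb (fun i => (ha i).1) ht
    (fun i hi => ⟨⟨i, rfl⟩, hi⟩)
  exact ⟨D, hD, fun i hx => by simpa using hDU i hx, hdisj⟩

end SimpleGraph

/-! ### The star graph: regularity, no triangles, no quadrangles -/

open SimpleGraph

/-- The star graph on the permutations of `Fin n`. -/
def permStarGraph (n : ℕ) : SimpleGraph (Equiv.Perm (Fin n)) where
  Adj := IsStarSwap
  symm := ⟨fun _ _ h => h.symm⟩
  loopless := ⟨fun _ h => h.ne rfl⟩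

theorem isStarSwap_iff {k : ℕ} {u v : Equiv.Perm (Fin (k + 1))} :
    IsStarSwap u v ↔ ∃ i : Fin k, v = u * Equiv.swap 0 i.succ := by
  constructor
  · intro h
    obtain ⟨a, i, ha, hi, h⟩ := h.symm
    obtain rfl : a = 0 := Fin.ext ha
    have hi0 : i ≠ 0 := fun h => hi (by simp [h])
    obtain ⟨j, rfl⟩ := Fin.exists_succ_eq.mpr hi0
    exact ⟨j, h⟩
  · rintro ⟨i, rfl⟩
    exact IsStarSwap.symm ⟨0, i.succ, rfl, by simp, rfl⟩

/-- The neighbours of `p` in the star graph. -/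
def starNeighbor {k : ℕ} (p : Equiv.Perm (Fin (k + 1))) (i : Fin k) : Equiv.Perm (Fin (k + 1)) :=
  p * Equiv.swap 0 i.succ

theorem starNeighbor_injective {k : ℕ} (p : Equiv.Perm (Fin (k + 1))) :
    Function.Injective (starNeighbor p) := by
  intro i j h
  have h1 : Equiv.swap (0 : Fin (k + 1)) i.succ = Equiv.swap 0 j.succ := mul_left_cancel h
  have h2 := congrArg (fun σ : Equiv.Perm (Fin (k + 1)) => σ 0) h1
  simpa using h2

theorem permStarGraph_adj_iff {k : ℕ} {p q : Equiv.Perm (Fin (k + 1))} :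
    (permStarGraph (k + 1)).Adj p q ↔ q ∈ Set.range (starNeighbor p) := by
  refine isStarSwap_iff.trans ⟨?_, ?_⟩
  · rintro ⟨i, rfl⟩; exact ⟨i, rfl⟩
  · rintro ⟨i, rfl⟩; exact ⟨i, rfl⟩

theorem permStarGraph_ncard_neighbors {k : ℕ} (p : Equiv.Perm (Fin (k + 1))) :
    {q | (permStarGraph (k + 1)).Adj p q}.ncard = k := by
  have : {q | (permStarGraph (k + 1)).Adj p q} = Set.range (starNeighbor p) := by
    ext q; exact permStarGraph_adj_iff
  rw [this, ← Set.image_univ, Set.ncard_image_of_injective _ (starNeighbor_injective p),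
    Set.ncard_univ]
  simp

theorem permStarGraph_sign {n : ℕ} {p q : Equiv.Perm (Fin n)} (h : (permStarGraph n).Adj p q) :
    Equiv.Perm.sign p = - Equiv.Perm.sign q := by
  obtain ⟨a, i, ha, hi, rfl⟩ := h
  have : a ≠ i := fun h => hi (h ▸ ha)
  simp [Equiv.Perm.sign_swap this]

/-- Adjacent permutations have opposite signs, so the graph is bipartite. -/
theorem permStarGraph_triangle_free {n : ℕ} {p q r : Equiv.Perm (Fin n)} (h : (permStarGraph n).Adj p q)
    (h' : (permStarGraph n).Adj q r) : ¬ (permStarGraph n).Adj p r := by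
  intro h''
  have h1 := permStarGraph_sign h
  have h2 := permStarGraph_sign h'
  have h3 := permStarGraph_sign h''
  rw [h2, neg_neg] at h1
  rw [h1] at h3
  exact units_ne_neg_self _ h3

/-- If r = p (0 i) = q (0 j) with p ≠ q, then i ≠ j and p⁻¹q = (0 i)(0 j) sends 0 to j. So p and q
determine j, and with it r. -/
theorem permStarGraph_common_neighbor_unique {n : ℕ} {p q r s : Equiv.Perm (Fin n)} (hpq : p ≠ q)
    (h1 : (permStarGraph n).Adj p r) (h2 : (permStarGraph n).Adj q r) (h3 : (permStarGraph n).Adj p s)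
    (h4 : (permStarGraph n).Adj q s) : r = s := by
  obtain ⟨k, rfl⟩ : ∃ k, n = k + 1 := by
    obtain ⟨a, -⟩ := h1
    exact Nat.exists_eq_succ_of_ne_zero (by have := a.2; omega)
  have key : ∀ r, (permStarGraph (k + 1)).Adj p r → (permStarGraph (k + 1)).Adj q r →
      r = q * Equiv.swap 0 ((p⁻¹ * q) 0) := by
    intro r h1 h2
    obtain ⟨i, rfl⟩ := permStarGraph_adj_iff.mp h1
    obtain ⟨j, hj⟩ := permStarGraph_adj_iff.mp h2
    have hij : i ≠ j := by
      rintro rfl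
      exact hpq (mul_right_cancel hj).symm
    have e : p⁻¹ * q = Equiv.swap 0 i.succ * Equiv.swap 0 j.succ := by
      unfold starNeighbor at hj
      rw [inv_mul_eq_iff_eq_mul, ← mul_assoc, ← hj, mul_assoc, Equiv.swap_mul_self, mul_one]
    have e0 : (p⁻¹ * q) 0 = j.succ := by
      rw [e, Equiv.Perm.mul_apply, Equiv.swap_apply_left, Equiv.swap_apply_of_ne_of_ne]
      · simp
      · simpa using hij.symm
    rw [e0]
    exact hj.symm
  rw [key r h1 h2, key s h3 h4]

/-! ### Connectivity of the star graph, by induction over cosets -/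

/-- The permutations which agree with `g` outside `J` and the first position. -/
def starCoset {k : ℕ} (J : Finset (Fin (k + 1))) (g : Equiv.Perm (Fin (k + 1))) :
    Set (Equiv.Perm (Fin (k + 1))) :=
  {h | ∀ i, i ≠ 0 → i ∉ J → h i = g i}

theorem mul_mem_starCoset {k : ℕ} {J : Finset (Fin (k + 1))} {g h : Equiv.Perm (Fin (k + 1))}
    (hh : h ∈ starCoset J g) {a b : Fin (k + 1)} (ha : a = 0 ∨ a ∈ J) (hb : b = 0 ∨ b ∈ J) :
    h * Equiv.swap a b ∈ starCoset J g := by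
  intro i hi hiJ
  rw [Equiv.Perm.mul_apply, Equiv.swap_apply_of_ne_of_ne]
  · exact hh i hi hiJ
  · rintro rfl; tauto
  · rintro rfl; tauto

/-- Prescribing the value at `m` cuts a coset for `insert m J` into cosets for `J`, the smaller star
graphs on which the induction runs. -/
theorem starCoset_insert {k : ℕ} {J : Finset (Fin (k + 1))} {g h h' : Equiv.Perm (Fin (k + 1))}
    {m : Fin (k + 1)} (hh : h ∈ starCoset (insert m J) g) (hh' : h' ∈ starCoset (insert m J) g)
    (e : h' m = h m) : h' ∈ starCoset J h := by
  intro i hi hiJ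
  by_cases him : i = m
  · rw [him, e]
  · have : i ∉ insert m J := by simp [him, hiJ]
    rw [hh i hi this, hh' i hi this]

theorem starCoset_subset_insert {k : ℕ} {J : Finset (Fin (k + 1))}
    {g h : Equiv.Perm (Fin (k + 1))} {m : Fin (k + 1)} (hm0 : m ≠ 0) (hmJ : m ∉ J)
    (hh : h ∈ starCoset (insert m J) g) {h' : Equiv.Perm (Fin (k + 1))}
    (hh' : h' ∈ starCoset J h) : h' ∈ starCoset (insert m J) g ∧ h' m = h m := by
  refine ⟨fun i hi hiJ => ?_, hh' m hm0 hmJ⟩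
  rw [hh' i hi (fun h => hiJ (Finset.mem_insert_of_mem h)), hh i hi hiJ]

/-- Swapping positions `0` and `m` of such an `h` exchanges `v` and `w`. Hence any two subcosets,
given by different values at `m`, are joined by an edge. -/
theorem exists_mem_starCoset {k : ℕ} {J : Finset (Fin (k + 1))} (g : Equiv.Perm (Fin (k + 1)))
    {m : Fin (k + 1)} (hm0 : m ≠ 0) (hm : m ∈ J) {v w : Fin (k + 1)}
    (hv : v ∈ (insert 0 J).image g) (hw : w ∈ (insert 0 J).image g) (hvw : v ≠ w) :
    ∃ h ∈ starCoset J g, h m = v ∧ h 0 = w := by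
  obtain ⟨b, hb, rfl⟩ := Finset.mem_image.mp hv
  obtain ⟨a, ha, rfl⟩ := Finset.mem_image.mp hw
  have hab : b ≠ a := fun h => hvw (h ▸ rfl)
  rw [Finset.mem_insert] at ha hb
  have hc0 : Equiv.swap 0 a b ≠ 0 := by
    intro h
    apply hab
    have := congrArg (Equiv.swap 0 a) h
    simpa using this
  have hcJ : Equiv.swap 0 a b = 0 ∨ Equiv.swap 0 a b ∈ J := by
    by_cases hb0 : b = 0
    · rw [hb0, Equiv.swap_apply_left]; exact ha
    · rw [Equiv.swap_apply_of_ne_of_ne hb0 hab]; exact hb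
  -- The first transposition brings `w` to position `0`; the second takes `v` from its position
  -- after that to position `m`.
  refine ⟨g * Equiv.swap 0 a * Equiv.swap m (Equiv.swap 0 a b),
    mul_mem_starCoset (mul_mem_starCoset (fun i _ _ => rfl) (Or.inl rfl) ha) (Or.inr hm) hcJ,
    ?_, ?_⟩
  · simp
  · rw [Equiv.Perm.mul_apply, Equiv.swap_apply_of_ne_of_ne hm0.symm hc0.symm]
    simp

theorem apply_mem_image_of_mem_starCoset {k : ℕ} {J : Finset (Fin (k + 1))}
    {g h : Equiv.Perm (Fin (k + 1))} {m : Fin (k + 1)} (hh : h ∈ starCoset (insert m J) g) :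
    h m ∈ (insert 0 (insert m J)).image g := by
  refine Finset.mem_image.mpr ⟨g⁻¹ (h m), ?_, by simp⟩
  by_contra hno
  rw [Finset.mem_insert, not_or] at hno
  have e := hh _ hno.1 hno.2
  rw [show g (g⁻¹ (h _)) = h _ from g.apply_symm_apply _] at e
  have e' : g⁻¹ (h m) = m := h.injective e
  exact hno.2 (by rw [e']; exact Finset.mem_insert_self m J)

theorem permStarGraph_adj_swap {k : ℕ} {m : Fin (k + 1)} (hm : m ≠ 0)
    (h : Equiv.Perm (Fin (k + 1))) : (permStarGraph (k + 1)).Adj h (h * Equiv.swap 0 m) := by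
  obtain ⟨j, rfl⟩ := Fin.exists_succ_eq.mpr hm
  exact permStarGraph_adj_iff.mpr ⟨j, rfl⟩

/-- The star graph on each coset cannot be separated by too few elements, inductive step in the
case that all separating elements agree at the new position `m`. -/
theorem starCoset_not_separated_of_forall_eq {k : ℕ} {J : Finset (Fin (k + 1))}
    {g : Equiv.Perm (Fin (k + 1))} {m u : Fin (k + 1)} (hm0 : m ≠ 0) {L R : Set _}
    (hs : (permStarGraph (k + 1)).IsSeparation L R)
    (hpure : ∀ h ∈ starCoset (insert m J) g, h m ≠ u →
      (∀ h' ∈ starCoset J h, h' ∈ L → h' ∈ R) ∨ ∀ h' ∈ starCoset J h, h' ∈ R → h' ∈ L)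
    (hu : ∀ h ∈ starCoset (insert m J) g, h ∈ L → h ∈ R → h m = u)
    {l r : Equiv.Perm (Fin (k + 1))} (hl : l ∈ starCoset (insert m J) g) (hlR : l ∉ R)
    (hr : r ∈ starCoset (insert m J) g) (hrL : r ∉ L) : False := by
  have hcov : ∀ h, h ∈ L ∪ R := fun h => hs.1 ▸ Set.mem_univ h
  have hswap : ∀ h ∈ starCoset (insert m J) g, h * Equiv.swap 0 m ∈ starCoset (insert m J) g :=
    fun h hh => mul_mem_starCoset hh (Or.inl rfl) (Or.inr (Finset.mem_insert_self m J))
  have hedge : ∀ h, h ∉ R → h * Equiv.swap 0 m ∉ L → False := fun h h1 h2 =>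
    hs.2 _ _ ((hcov h).resolve_right h1) h1 ((hcov _).resolve_left h2) h2
      (permStarGraph_adj_swap hm0 h)
  have hedge' : ∀ h, h ∉ L → h * Equiv.swap 0 m ∉ R → False := fun h h1 h2 =>
    hedge (h * Equiv.swap 0 m) h2 (by simpa [mul_assoc] using h1)
  have hm' : ∀ h : Equiv.Perm (Fin (k + 1)), (h * Equiv.swap 0 m) m ≠ h m := by
    intro h e
    rw [Equiv.Perm.mul_apply, Equiv.swap_apply_right] at e
    exact hm0 (h.injective e).symm
  -- An `l` with value `u` at `m` is replaced by its neighbour across `swap 0 m`: this cannot change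
  -- sides, and it lands where no separating element lies.
  obtain ⟨l, hl, hlR, hlu⟩ : ∃ l ∈ starCoset (insert m J) g, l ∉ R ∧ l m ≠ u := by
    by_cases h : l m = u
    · have h1 : (l * Equiv.swap 0 m) m ≠ u := h ▸ hm' l
      have h2 : l * Equiv.swap 0 m ∈ L := by_contra fun h => hedge l hlR h
      exact ⟨_, hswap l hl, fun h3 => h1 (hu _ (hswap l hl) h2 h3), h1⟩
    · exact ⟨l, hl, hlR, h⟩
  obtain ⟨r, hr, hrL, hru⟩ : ∃ r ∈ starCoset (insert m J) g, r ∉ L ∧ r m ≠ u := by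
    by_cases h : r m = u
    · have h1 : (r * Equiv.swap 0 m) m ≠ u := h ▸ hm' r
      have h2 : r * Equiv.swap 0 m ∈ R := by_contra fun h => hedge' r hrL h
      exact ⟨_, hswap r hr, fun h3 => h1 (hu _ (hswap r hr) h3 h2), h1⟩
    · exact ⟨r, hr, hrL, h⟩
  have hmem := fun h hh => apply_mem_image_of_mem_starCoset (J := J) (g := g) (h := h) (m := m) hh
  have hl1 : ∀ h' ∈ starCoset J l, h' ∈ R → h' ∈ L := by
    refine (hpure l hl hlu).resolve_left fun h => ?_
    exact hlR (h l (fun _ _ _ => rfl) ((hcov l).resolve_right hlR))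
  have hr1 : ∀ h' ∈ starCoset J r, h' ∈ L → h' ∈ R := by
    refine (hpure r hr hru).resolve_right fun h => ?_
    exact hrL (h r (fun _ _ _ => rfl) ((hcov r).resolve_left hrL))
  have hne : l m ≠ r m := fun e =>
    hrL (hl1 r (starCoset_insert hl hr e.symm) ((hcov r).resolve_left hrL))
  -- The subcosets of `l` and `r` lie on opposite sides and contain no separating element, so the
  -- edge between them is a forbidden crossing.
  obtain ⟨h, hh, hhm, hh0⟩ := exists_mem_starCoset g hm0 (Finset.mem_insert_self m J)
    (hmem l hl) (hmem r hr) hne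
  have hh'm : (h * Equiv.swap 0 m) m = r m := by simpa using hh0
  have a1 : h ∉ R := fun hR => hlu (hhm ▸ hu h hh (hl1 h (starCoset_insert hl hh hhm) hR) hR)
  have a2 : h * Equiv.swap 0 m ∉ L := fun hL => hru (hh'm ▸ hu _ (hswap h hh) hL
    (hr1 _ (starCoset_insert hr (hswap h hh) hh'm) hL))
  exact hedge h a1 a2

/-- The star graph on each coset cannot be separated by too few elements, inductive step in the
case that no subcoset is separated. -/
theorem card_le_ncard_of_starCoset_separated {k : ℕ} {J : Finset (Fin (k + 1))}
    {g : Equiv.Perm (Fin (k + 1))} {m : Fin (k + 1)} (hm0 : m ≠ 0) (h0 : 0 ∉ insert m J)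
    {L R : Set _} (hs : (permStarGraph (k + 1)).IsSeparation L R)
    (hpure : ∀ h ∈ starCoset (insert m J) g,
      (∀ h' ∈ starCoset J h, h' ∈ L → h' ∈ R) ∨ ∀ h' ∈ starCoset J h, h' ∈ R → h' ∈ L)
    {l r : Equiv.Perm (Fin (k + 1))} (hl : l ∈ starCoset (insert m J) g) (hlR : l ∉ R)
    (hr : r ∈ starCoset (insert m J) g) (hrL : r ∉ L) :
    (insert m J).card ≤ ((L ∩ R) ∩ starCoset (insert m J) g).ncard := by
  classical
  have hcov : ∀ h, h ∈ L ∪ R := fun h => hs.1 ▸ Set.mem_univ h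
  have hswap : ∀ h ∈ starCoset (insert m J) g, h * Equiv.swap 0 m ∈ starCoset (insert m J) g :=
    fun h hh => mul_mem_starCoset hh (Or.inl rfl) (Or.inr (Finset.mem_insert_self m J))
  have hmem := fun h hh => apply_mem_image_of_mem_starCoset (J := J) (g := g) (h := h) (m := m) hh
  set I := (insert 0 (insert m J)).image g with hI
  have hIcard : I.card = (insert m J).card + 1 := by
    rw [hI, Finset.card_image_of_injective _ g.injective, Finset.card_insert_of_notMem h0]
  set A := I.filter fun v => ∃ h ∈ starCoset (insert m J) g, h m = v ∧ h ∉ R with hA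
  set B := I.filter fun v => ¬ ∃ h ∈ starCoset (insert m J) g, h m = v ∧ h ∉ R with hB
  have hAB : A.card + B.card = I.card := Finset.card_filter_add_card_filter_not _
  have hAL : ∀ h ∈ starCoset (insert m J) g, h m ∈ A → h ∈ L := by
    intro h hh hhA
    obtain ⟨-, h', hh', e, hR⟩ := Finset.mem_filter.mp hhA
    rcases hpure h' hh' with hp | hp
    · exact absurd (hp h' (fun _ _ _ => rfl) ((hcov h').resolve_right hR)) hR
    · exact (hcov h).elim id (hp h (starCoset_insert hh' hh e.symm))
  have hBR : ∀ h ∈ starCoset (insert m J) g, h m ∈ B → h ∈ R := by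
    intro h hh hhB
    by_contra hR
    exact (Finset.mem_filter.mp hhB).2 ⟨h, hh, rfl, hR⟩
  have hA1 : 0 < A.card :=
    Finset.card_pos.mpr ⟨l m, Finset.mem_filter.mpr ⟨hmem l hl, l, hl, rfl, hlR⟩⟩
  have hB1 : 0 < B.card := by
    refine Finset.card_pos.mpr ⟨r m, Finset.mem_filter.mpr ⟨hmem r hr, fun hex => ?_⟩⟩
    exact hrL (hAL r hr (Finset.mem_filter.mpr ⟨hmem r hr, hex⟩))
  have hdisj : ∀ v, v ∈ A → v ∈ B → False := fun v h1 h2 =>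
    (Finset.mem_filter.mp h2).2 (Finset.mem_filter.mp h1).2
  -- The edge between the subcosets of `v ∈ A` and `w ∈ B` has an end in `L ∩ R`. Its values at `m`
  -- and `0` are `v` and `w` in some order, and they give back the pair as `A` and `B` are disjoint.
  -- So at least `|A| * |B|` separating elements are needed.
  have hex : ∀ vw : Fin (k + 1) × Fin (k + 1), vw ∈ A ×ˢ B → ∃ h ∈ (L ∩ R) ∩
      starCoset (insert m J) g, (h m = vw.1 ∧ h 0 = vw.2) ∨ (h 0 = vw.1 ∧ h m = vw.2) := by
    rintro ⟨v, w⟩ hvw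
    obtain ⟨hv, hw⟩ := Finset.mem_product.mp hvw
    obtain ⟨h, hh, rfl, rfl⟩ := exists_mem_starCoset g hm0 (Finset.mem_insert_self m J)
      (Finset.mem_filter.mp hv).1 (Finset.mem_filter.mp hw).1 (fun e => hdisj v hv (by
        have e : v = w := e
        rw [e]; exact hw))
    have h1 := hAL h hh hv
    have h2 : h * Equiv.swap 0 m ∈ R := hBR _ (hswap h hh) (by simpa using hw)
    by_cases hR : h ∈ R
    · exact ⟨h, ⟨⟨h1, hR⟩, hh⟩, Or.inl ⟨rfl, rfl⟩⟩
    · have hL : h * Equiv.swap 0 m ∈ L := by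
        by_contra hL
        exact hs.2 _ _ h1 hR h2 hL (permStarGraph_adj_swap hm0 h)
      exact ⟨_, ⟨⟨hL, h2⟩, hswap h hh⟩, Or.inr (by simp)⟩
  choose! φ hφ hφ' using hex
  have hinj : Set.InjOn φ (A ×ˢ B : Finset _) := by
    rintro ⟨v, w⟩ h1 ⟨v', w'⟩ h2 e
    have e1 := hφ' _ h1
    have e2 := hφ' _ h2
    obtain ⟨hv, hw⟩ := Finset.mem_product.mp h1
    obtain ⟨hv', hw'⟩ := Finset.mem_product.mp h2
    simp only at e1 e2 hv hw hv' hw'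
    rw [e] at e1
    rcases e1 with ⟨a1, a2⟩ | ⟨a1, a2⟩ <;> rcases e2 with ⟨b1, b2⟩ | ⟨b1, b2⟩
    · rw [← a1, ← a2, b1, b2]
    · exact (hdisj v hv (by rw [← a1, b2]; exact hw')).elim
    · exact (hdisj v' hv' (by rw [← b1, a2]; exact hw)).elim
    · rw [← a1, ← a2, b1, b2]
  have hle : (A ×ˢ B).card ≤ ((L ∩ R) ∩ starCoset (insert m J) g).ncard := by
    rw [← Set.ncard_coe_finset, ← hinj.ncard_image]
    refine Set.ncard_le_ncard ?_ (Set.toFinite _)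
    rintro _ ⟨vw, h, rfl⟩
    exact hφ _ h
  rw [Finset.card_product] at hle
  refine le_trans ?_ hle
  -- With both factors positive, (a + 1)(b + 1) ≥ a + b + 1, and the right side is the size of
  -- `insert m J`.
  obtain ⟨a, ha⟩ : ∃ a, A.card = a + 1 := ⟨A.card - 1, by omega⟩
  obtain ⟨b, hb⟩ : ∃ b, B.card = b + 1 := ⟨B.card - 1, by omega⟩
  rw [hIcard, ha, hb] at hAB
  rw [ha, hb]
  nlinarith [Nat.zero_le (a * b)]

/-- A coset of the star graph on `J ∪ {0}` is not separated by fewer than `|J|` elements. -/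
theorem starCoset_not_separated {k : ℕ} (J : Finset (Fin (k + 1))) (h0 : 0 ∉ J)
    (g : Equiv.Perm (Fin (k + 1))) {L R : Set _}
    (hs : (permStarGraph (k + 1)).IsSeparation L R)
    (hcard : ((L ∩ R) ∩ starCoset J g).ncard ≤ J.card - 1) :
    (∀ h ∈ starCoset J g, h ∈ L → h ∈ R) ∨ ∀ h ∈ starCoset J g, h ∈ R → h ∈ L := by
  induction J using Finset.induction_on generalizing g with
  -- The subtraction truncates here, but the coset is a single permutation and cannot be separated
  -- at all.
  | empty =>
    have hsingle : ∀ h ∈ starCoset ∅ g, h = g := by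
      intro h hh
      have hne : ∀ i, i ≠ 0 → h i = g i := fun i hi => hh i hi (by simp)
      have h00 : g⁻¹ (h 0) = 0 := by
        by_contra hno
        have e := hne _ hno
        rw [show g (g⁻¹ (h _)) = h _ from g.apply_symm_apply _] at e
        exact hno (h.injective e)
      ext1 i
      by_cases hi : i = 0
      · rw [hi, ← Equiv.Perm.inv_eq_iff_eq.mp h00]
      · exact hne i hi
    by_cases hg : g ∈ R
    · exact Or.inl fun h hh _ => hsingle h hh ▸ hg
    · exact Or.inr fun h hh hR => absurd (hsingle h hh ▸ hR) hg
  | insert m J hmJ ih =>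
    have hm0 : m ≠ 0 := fun h => h0 (h ▸ Finset.mem_insert_self m J)
    have h0J : 0 ∉ J := fun h => h0 (Finset.mem_insert_of_mem h)
    rw [Finset.card_insert_of_notMem hmJ, Nat.add_sub_cancel] at hcard
    by_contra hno
    rw [not_or] at hno
    push Not at hno
    obtain ⟨⟨l, hl, -, hlR⟩, r, hr, -, hrL⟩ := hno
    have hsub : ∀ h ∈ starCoset (insert m J) g, (L ∩ R) ∩ starCoset J h ⊆
        (L ∩ R) ∩ starCoset (insert m J) g := fun h hh h' hh' =>
      ⟨hh'.1, (starCoset_subset_insert hm0 hmJ hh hh'.2).1⟩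
    -- If the separating elements share one value at `m`, all other subcosets are free of them.
    -- Otherwise every subcoset misses at least one, and the induction hypothesis applies to each.
    by_cases hu : ∃ u, ∀ h ∈ starCoset (insert m J) g, h ∈ L → h ∈ R → h m = u
    · obtain ⟨u, hu⟩ := hu
      refine starCoset_not_separated_of_forall_eq hm0 hs (fun h hh hhu => ih h0J h ?_) hu hl hlR
        hr hrL
      have : (L ∩ R) ∩ starCoset J h = ∅ := by
        rw [Set.eq_empty_iff_forall_notMem]
        rintro h' ⟨⟨h1, h2⟩, h3⟩
        obtain ⟨h4, h5⟩ := starCoset_subset_insert hm0 hmJ hh h3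
        exact hhu (h5 ▸ hu h' h4 h1 h2)
      rw [this, Set.ncard_empty]
      exact Nat.zero_le _
    · push Not at hu
      have := card_le_ncard_of_starCoset_separated hm0 h0 hs (fun h hh => ih h0J h ?_) hl hlR
        hr hrL
      · rw [Finset.card_insert_of_notMem hmJ] at this
        omega
      · obtain ⟨h', hh', h1, h2, h3⟩ := hu (h m)
        have hlt := Set.ncard_lt_ncard (s := (L ∩ R) ∩ starCoset J h)
          (t := (L ∩ R) ∩ starCoset (insert m J) g) ⟨hsub h hh, fun hsup =>
            h3 ((starCoset_subset_insert hm0 hmJ hh (hsup ⟨⟨h1, h2⟩, hh'⟩).2).2)⟩ (Set.toFinite _)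
        omega

/-- The star graph on the permutations of `k + 1` symbols is `k`-connected. -/
theorem permStarGraph_isWellConnected (k : ℕ) : (permStarGraph (k + 1)).IsWellConnected k := by
  intro L R hs hcard
  have huniv : ∀ h, h ∈ starCoset (Finset.univ.erase 0) (1 : Equiv.Perm (Fin (k + 1))) := by
    intro h i hi hiJ
    simp [hi] at hiJ
  rcases starCoset_not_separated (Finset.univ.erase 0) (by simp) 1 hs (by
    rw [Finset.card_erase_of_mem (Finset.mem_univ _), Finset.card_univ, Fintype.card_fin]
    have := Set.ncard_le_ncard (Set.inter_subset_left (s := L ∩ R)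
      (t := starCoset (Finset.univ.erase 0) (1 : Equiv.Perm (Fin (k + 1))))) (Set.toFinite _)
    omega) with h | h
  · exact Or.inl fun x hx => h x (huniv x) hx
  · exact Or.inr fun x hx => h x (huniv x) hx

/-! ### From packings to trees -/

/-- The edges of `G` within `U`, except that of those inside `S` only the ones in `F` are kept. -/
def stepGraph {V : Type*} (G : SimpleGraph V) (S U : Set V) (F : Set (Sym2 V)) :
    SimpleGraph V where
  Adj u v := G.Adj u v ∧ u ∈ U ∧ v ∈ U ∧ (u ∈ S → v ∈ S → s(u, v) ∈ F)
  symm := ⟨fun _ _ h => ⟨h.1.symm, h.2.2.1, h.2.1, fun h1 h2 => Sym2.eq_swap ▸ h.2.2.2 h2 h1⟩⟩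
  loopless := ⟨fun _ h => h.1.ne rfl⟩

/-- Disjoint sets `W i` of inner vertices and disjoint sets `F i` of edges inside `S` such that
`W i` together with `F i` connects `S`. -/
structure IsSteinerPacking {V ι : Type*} (G : SimpleGraph V) (S : Set V) (W : ι → Set V)
    (F : ι → Set (Sym2 V)) : Prop where
  notMem : ∀ i, ∀ v ∈ W i, v ∉ S
  disjoint : ∀ i j v, v ∈ W i → v ∈ W j → i = j
  disjoint_edges : ∀ i j e, e ∈ F i → e ∈ F j → i = j
  reachable : ∀ i, ∃ b, ∀ v ∈ W i ∪ S, (stepGraph G S (W i ∪ S) (F i)).Reachable v b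

/-- A graph `H ≤ G` with its edges inside `U` which connects `U` contains a tree spanning `U`. -/
theorem exists_tree_subgraph {V : Type*} {G H : SimpleGraph V} {U : Set V} (hHG : H ≤ G)
    (hU : ∀ u v, H.Adj u v → u ∈ U ∧ v ∈ U) (hne : U.Nonempty)
    (hr : ∀ u ∈ U, ∀ v ∈ U, H.Reachable u v) :
    ∃ T : G.Subgraph, T.coe.IsTree ∧ T.verts = U ∧ ∀ u v, T.Adj u v → H.Adj u v := by
  have hwalk : ∀ u v (_ : H.Walk u v) (hu : u ∈ U) (hv : v ∈ U),
      (H.induce U).Reachable ⟨u, hu⟩ ⟨v, hv⟩ := by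
    intro u v p
    induction p with
    | nil => exact fun _ _ => Reachable.refl _
    | cons h p ih =>
      intro hu hv
      have hw := (hU _ _ h).2
      have h' : (H.induce U).Adj ⟨_, hu⟩ ⟨_, hw⟩ := h
      exact h'.reachable.trans (ih hw hv)
  have hconn : (H.induce U).Connected :=
    { preconnected := fun u v => by
        obtain ⟨p⟩ := hr u u.2 v v.2
        exact hwalk _ _ p u.2 v.2
      nonempty := hne.to_subtype }
  obtain ⟨T, hT, htree⟩ := hconn.exists_isTree_le
  refine ⟨{ verts := U
            Adj := fun u v => ∃ (hu : u ∈ U) (hv : v ∈ U), T.Adj ⟨u, hu⟩ ⟨v, hv⟩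
            adj_sub := ?_
            edge_vert := ?_
            symm := ⟨?_⟩ }, ?_, rfl, ?_⟩
  · rintro u v ⟨_, _, h⟩
    exact hHG (hT h)
  · rintro u v ⟨hu, _, _⟩
    exact hu
  · rintro u v ⟨hu, hv, h⟩
    exact ⟨hv, hu, h.symm⟩
  · convert htree using 1
    ext u v
    exact ⟨fun ⟨_, _, h⟩ => h, fun h => ⟨u.2, v.2, h⟩⟩
  · rintro u v ⟨_, _, h⟩
    exact hT h

/-- An edge common to two of the spanning trees has both ends in `S`, since inner vertices are not
shared. Inside `S` only the disjoint sets `F i` are available. -/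
theorem IsSteinerPacking.exists_trees {V ι : Type*} {G : SimpleGraph V} {S : Set V}
    {W : ι → Set V} {F : ι → Set (Sym2 V)} (h : IsSteinerPacking G S W F) (hS : S.Nonempty) :
    ∃ T : ι → G.Subgraph, InternallyEdgeDisjointSTrees S T := by
  have key : ∀ i, ∃ T : G.Subgraph, T.coe.IsTree ∧ T.verts = W i ∪ S ∧
      ∀ u v, T.Adj u v → (stepGraph G S (W i ∪ S) (F i)).Adj u v := by
    intro i
    obtain ⟨b, hb⟩ := h.reachable i
    exact exists_tree_subgraph (fun u v huv => huv.1) (fun u v huv => ⟨huv.2.1, huv.2.2.1⟩)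
      (hS.mono Set.subset_union_right) (fun u hu v hv => (hb u hu).trans (hb v hv).symm)
  choose T hT hTv hTadj using key
  refine ⟨T, fun i => ⟨hT i, hTv i ▸ Set.subset_union_right⟩, fun i j hij => ⟨?_, ?_⟩⟩
  · ext v
    simp only [hTv, Set.mem_inter_iff, Set.mem_union]
    have := h.disjoint i j v
    tauto
  · rw [Set.eq_empty_iff_forall_notMem]
    intro e
    induction e using Sym2.ind with
    | _ u v =>
    rintro ⟨h1, h2⟩
    obtain ⟨-, hu1, hv1, hF1⟩ := hTadj i u v h1
    obtain ⟨-, hu2, hv2, hF2⟩ := hTadj j u v h2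
    have hu : u ∈ S := by
      by_contra hu
      exact hij (h.disjoint i j u (hu1.resolve_right hu) (hu2.resolve_right hu))
    have hv : v ∈ S := by
      by_contra hv
      exact hij (h.disjoint i j v (hv1.resolve_right hv) (hv2.resolve_right hv))
    exact hij (h.disjoint_edges i j _ (hF1 hu hv) (hF2 hu hv))

/-! ### Upper bound by degrees -/

/-- If there are at least `deg x` internally edge disjoint `S`-trees, every edge at `x` lies in one
of them, and each of them has only one edge at `x`. -/
theorem InternallyEdgeDisjointSTrees.edges_at {V : Type*} [Finite V] {G : SimpleGraph V}
    {S : Set V} {r : ℕ} {T : Fin r → G.Subgraph} (h : InternallyEdgeDisjointSTrees S T) {x z : V}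
    (hx : x ∈ S) (hz : z ∈ S) (hxz : x ≠ z) (hd : {w | G.Adj x w}.ncard ≤ r) :
    (∀ w, G.Adj x w → ∃ i, (T i).Adj x w) ∧
      ∀ i w w', (T i).Adj x w → (T i).Adj x w' → w = w' := by
  have hex : ∀ i, ∃ w, (T i).Adj x w := by
    intro i
    have hx' := (h.1 i).2 hx
    have hz' := (h.1 i).2 hz
    obtain ⟨p⟩ := (h.1 i).1.connected.preconnected ⟨x, hx'⟩ ⟨z, hz'⟩
    cases p with
    | nil => exact absurd rfl hxz
    | cons e _ => exact ⟨_, e⟩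
  -- The edges chosen at `x` are distinct and at least as many as the degree, so they are all the
  -- edges at `x`.
  choose φ hφ using hex
  have hdisj : ∀ i j w, (T i).Adj x w → (T j).Adj x w → i = j := by
    intro i j w h1 h2
    by_contra hij
    have : s(x, w) ∈ (T i).edgeSet ∩ (T j).edgeSet := ⟨h1, h2⟩
    rw [(h.2 i j hij).2] at this
    exact this
  have hinj : Function.Injective φ := fun i j hij =>
    hdisj i j (φ i) (hφ i) (hij ▸ hφ j)
  have hrange : Set.range φ = {w | G.Adj x w} := by
    apply Set.eq_of_subset_of_ncard_le
    · rintro _ ⟨i, rfl⟩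
      exact (T i).adj_sub (hφ i)
    · rw [← Set.image_univ, Set.ncard_image_of_injective _ hinj, Set.ncard_univ]
      simpa using hd
    · exact Set.toFinite _
  have huniq : ∀ i w, (T i).Adj x w → w = φ i := by
    intro i w hw
    have : w ∈ Set.range φ := hrange ▸ (T i).adj_sub hw
    obtain ⟨j, rfl⟩ := this
    rw [hdisj i j _ hw (hφ j)]
  refine ⟨fun w hw => ?_, fun i w w' h1 h2 => (huniq i w h1).trans (huniq i w' h2).symm⟩
  have : w ∈ Set.range φ := hrange ▸ hw
  obtain ⟨i, rfl⟩ := this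
  exact ⟨i, hφ i⟩

/-- If `S` contains two adjacent vertices of degree at most `d` and a third vertex, there are fewer
than `d` internally edge disjoint `S`-trees. -/
theorem InternallyEdgeDisjointSTrees.lt_of_adj {V : Type*} [Finite V] {G : SimpleGraph V}
    {S : Set V} {r d : ℕ} {T : Fin r → G.Subgraph} (h : InternallyEdgeDisjointSTrees S T)
    {x y z : V} (hx : x ∈ S) (hy : y ∈ S) (hz : z ∈ S) (hxz : x ≠ z) (hyz : y ≠ z)
    (hxy : G.Adj x y) (hdx : {w | G.Adj x w}.ncard ≤ d) (hdy : {w | G.Adj y w}.ncard ≤ d) :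
    r < d := by
  by_contra hr
  push Not at hr
  obtain ⟨h1, h2⟩ := h.edges_at hx hz hxz (hdx.trans hr)
  obtain ⟨-, h4⟩ := h.edges_at hy hz hyz (hdy.trans hr)
  obtain ⟨i, hi⟩ := h1 y hxy
  obtain ⟨p⟩ := (h.1 i).1.connected.preconnected ⟨x, (h.1 i).2 hx⟩ ⟨z, (h.1 i).2 hz⟩
  -- In the tree containing `xy` both ends are leaves, so no walk leaves `{x, y}`.
  have key : ∀ (u v : (T i).verts), (T i).coe.Walk u v → ((u : V) = x ∨ (u : V) = y) →
      ((v : V) = x ∨ (v : V) = y) := by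
    intro u v p
    induction p with
    | nil => exact id
    | @cons a b c e _ ih =>
      intro hu
      apply ih
      have e' : (T i).Adj a b := e
      rcases hu with hu | hu
      · right
        rw [hu] at e'
        exact h2 i _ _ e' hi
      · left
        rw [hu] at e'
        exact h4 i _ _ e' hi.symm
  rcases key _ _ p (Or.inl rfl) with h | h
  · exact hxz h.symm
  · exact hyz h.symm

/-! ### Clusters and outer edges of the hierarchical star graph -/

theorem last_ne_zero_of_pos {k : ℕ} (hk : 0 < k) : Fin.last k ≠ 0 := by
  intro h
  have := congrArg Fin.val h
  simp at this
  omega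

/-- The neighbour of `(c, p)` outside the cluster `c`. -/
def outerNeighbor {k : ℕ} (c p : Equiv.Perm (Fin (k + 1))) :
    Equiv.Perm (Fin (k + 1)) × Equiv.Perm (Fin (k + 1)) :=
  if p = c then (c * Equiv.swap 0 (Fin.last k), c * Equiv.swap 0 (Fin.last k)) else (p, c)

theorem mul_swap_last_ne {k : ℕ} (hk : 0 < k) (c : Equiv.Perm (Fin (k + 1))) :
    c * Equiv.swap 0 (Fin.last k) ≠ c := by
  intro h
  have h1 : Equiv.swap 0 (Fin.last k) = 1 := by simpa using h
  exact last_ne_zero_of_pos hk (Equiv.swap_eq_one_iff.mp h1).symm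

/-- The two rules for edges between clusters apply to `p = c` and `p ≠ c` respectively, so together
they give exactly one outer edge at each vertex. -/
theorem hierarchicalStarGraph_adj_iff {k : ℕ} (hk : 0 < k) {c p c' p' : Equiv.Perm (Fin (k + 1))} :
    (hierarchicalStarGraph (k + 1)).Adj (c, p) (c', p') ↔
      (c = c' ∧ (permStarGraph (k + 1)).Adj p p') ∨ (c', p') = outerNeighbor c p := by
  have hfl : ∀ u v : Equiv.Perm (Fin (k + 1)), IsFirstLastSwap u v ↔
      u = v * Equiv.swap 0 (Fin.last k) := by
    intro u v
    constructor
    · rintro ⟨a, b, ha, hb, rfl⟩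
      obtain rfl : a = 0 := Fin.ext ha
      obtain rfl : b = Fin.last k := Fin.ext (by simpa using hb)
      rfl
    · rintro rfl
      exact ⟨0, Fin.last k, rfl, rfl, rfl⟩
  have hadj : (hierarchicalStarGraph (k + 1)).Adj (c, p) (c', p') ↔
      (c = c' ∧ (permStarGraph (k + 1)).Adj p p') ∨
      (c ≠ c' ∧ c = p ∧ c' = p' ∧ IsFirstLastSwap c' c) ∨
      (c ≠ c' ∧ c ≠ p ∧ c = p' ∧ p = c') := Iff.rfl
  rw [hadj, hfl]
  refine or_congr Iff.rfl ?_
  unfold outerNeighbor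
  by_cases hpc : p = c
  · subst hpc
    have := (mul_swap_last_ne hk p).symm
    simp only [if_true, Prod.mk.injEq]
    constructor
    · rintro (⟨-, -, rfl, h⟩ | ⟨-, h, -⟩)
      · exact ⟨h, h⟩
      · exact absurd rfl h
    · rintro ⟨rfl, rfl⟩
      exact Or.inl ⟨this, trivial, rfl, rfl⟩
  · simp only [hpc, if_false, Prod.mk.injEq]
    constructor
    · rintro (⟨-, h, -⟩ | ⟨-, -, h1, h2⟩)
      · exact absurd h.symm hpc
      · exact ⟨h2.symm, h1.symm⟩
    · rintro ⟨rfl, rfl⟩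
      exact Or.inr ⟨fun h => hpc h.symm, fun h => hpc h.symm, rfl, rfl⟩

theorem hierarchicalStarGraph_adj_inner {k : ℕ} (hk : 0 < k) {c p q : Equiv.Perm (Fin (k + 1))}
    (h : (permStarGraph (k + 1)).Adj p q) :
    (hierarchicalStarGraph (k + 1)).Adj (c, p) (c, q) :=
  (hierarchicalStarGraph_adj_iff hk).mpr (Or.inl ⟨rfl, h⟩)

theorem hierarchicalStarGraph_adj_outer {k : ℕ} (hk : 0 < k) (c p : Equiv.Perm (Fin (k + 1))) :
    (hierarchicalStarGraph (k + 1)).Adj (c, p) (outerNeighbor c p) :=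
  (hierarchicalStarGraph_adj_iff hk).mpr (Or.inr rfl)

theorem hierarchicalStarGraph_adj_cross {k : ℕ} (hk : 0 < k) {c d : Equiv.Perm (Fin (k + 1))}
    (h : c ≠ d) : (hierarchicalStarGraph (k + 1)).Adj (c, d) (d, c) := by
  have := hierarchicalStarGraph_adj_outer hk c d
  rwa [outerNeighbor, if_neg h.symm] at this

theorem hierarchicalStarGraph_ncard_neighbors_le {k : ℕ} (hk : 0 < k)
    (x : Equiv.Perm (Fin (k + 1)) × Equiv.Perm (Fin (k + 1))) :
    {y | (hierarchicalStarGraph (k + 1)).Adj x y}.ncard ≤ k + 1 := by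
  obtain ⟨c, p⟩ := x
  have hsub : {y | (hierarchicalStarGraph (k + 1)).Adj (c, p) y} ⊆
      insert (outerNeighbor c p) ((fun q => (c, q)) '' {q | (permStarGraph (k + 1)).Adj p q}) := by
    rintro ⟨c', p'⟩ h
    rcases (hierarchicalStarGraph_adj_iff hk).mp h with ⟨rfl, h'⟩ | h'
    · exact Or.inr ⟨p', h', rfl⟩
    · exact Or.inl h'
  refine (Set.ncard_le_ncard hsub (Set.toFinite _)).trans ((Set.ncard_insert_le _ _).trans ?_)
  have := Set.ncard_image_le (f := fun q => (c, q))
    (Set.toFinite {q | (permStarGraph (k + 1)).Adj p q})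
  rw [permStarGraph_ncard_neighbors] at this
  omega

theorem generalizedConnectivity_hierarchicalStarGraph_le {k : ℕ} (hk : 0 < k) :
    generalizedConnectivity 3 (hierarchicalStarGraph (k + 1)) ≤ (k : ℕ∞) := by
  classical
  let c : Equiv.Perm (Fin (k + 1)) := 1
  let d : Equiv.Perm (Fin (k + 1)) := c * Equiv.swap 0 (Fin.last k)
  have hdc : d ≠ c := mul_swap_last_ne hk c
  have hadj : (hierarchicalStarGraph (k + 1)).Adj (c, c) (c, d) :=
    hierarchicalStarGraph_adj_inner hk (permStarGraph_adj_swap (last_ne_zero_of_pos hk) c)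
  have hxz : (c, c) ≠ (d, c) := fun h => hdc (congrArg Prod.fst h).symm
  have hyz : (c, d) ≠ (d, c) := fun h => hdc (congrArg Prod.fst h).symm
  have hcard : ({(c, c), (c, d), (d, c)} : Finset _).card = 3 :=
    Finset.card_eq_three.mpr ⟨_, _, _, hadj.ne, hxz, hyz, rfl⟩
  refine (iInf_le _ ⟨_, hcard⟩).trans (sSup_le ?_)
  rintro m ⟨r, T, hT, rfl⟩
  have := hT.lt_of_adj (x := (c, c)) (y := (c, d)) (z := (d, c)) (by simp) (by simp) (by simp)
    hxz hyz hadj (hierarchicalStarGraph_ncard_neighbors_le hk _)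
    (hierarchicalStarGraph_ncard_neighbors_le hk _)
  exact_mod_cast Nat.lt_succ_iff.mp this

/-! ### Packings for vertices in several clusters -/

theorem stepGraph_adj_of_notMem {V : Type*} {G : SimpleGraph V} {S U : Set V} {F : Set (Sym2 V)}
    {u v : V} (h : G.Adj u v) (hu : u ∈ U) (hv : v ∈ U) (hS : u ∉ S ∨ v ∉ S) :
    (stepGraph G S U F).Adj u v :=
  ⟨h, hu, hv, fun h1 h2 => (hS.elim (absurd h1) (absurd h2))⟩

/-- Used with `f` the inclusion of the star graph as a cluster, to carry joined sets over to the
packing. -/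
theorem stepGraph_reachable_of_joinedOn {V V' : Type*} {G : SimpleGraph V} {S U : Set V}
    {F : Set (Sym2 V)} {H : SimpleGraph V'} {f : V' → V}
    (hf : ∀ a b, H.Adj a b → G.Adj (f a) (f b)) {C : Set V'} (hC : H.JoinedOn C)
    (hU : ∀ q ∈ C, f q ∈ U) (hS : ∀ q ∈ C, f q ∉ S) {u v : V'} (hu : u ∈ C) (hv : v ∈ C) :
    (stepGraph G S U F).Reachable (f u) (f v) :=
  (hC u hu v hv).map (⟨f, fun {a b} hab => stepGraph_adj_of_notMem (hf a b hab.1) (hU a hab.2.1)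
    (hU b hab.2.2) (Or.inl (hS a hab.2.1))⟩ : H.within C →g stepGraph G S U F)

theorem SimpleGraph.IsStem.stepGraph_reachable {V V' : Type*} {G : SimpleGraph V} {S U : Set V}
    {F : Set (Sym2 V)} {H : SimpleGraph V'} {f : V' → V}
    (hf : ∀ a b, H.Adj a b → G.Adj (f a) (f b)) {p t : V'} {C : Set V'} (h : H.IsStem p t C)
    (hp : f p ∈ U) (hU : ∀ q ∈ C, f q ∈ U) (hS : ∀ q ∈ C, f q ∉ S) :
    f t ∈ U ∧ (stepGraph G S U F).Reachable (f p) (f t) ∧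
      ∀ q ∈ C, (stepGraph G S U F).Reachable (f q) (f t) := by
  rcases h.2 with ⟨rfl, rfl⟩ | ⟨ht, hC, q, hq, hpq⟩
  · exact ⟨hp, Reachable.refl _, by simp⟩
  · refine ⟨hU t ht, ?_, fun q hq => stepGraph_reachable_of_joinedOn hf hC hU hS hq ht⟩
    exact (stepGraph_adj_of_notMem (hf _ _ hpq) hp (hU q hq) (Or.inr (hS q hq))).reachable.trans
      (stepGraph_reachable_of_joinedOn hf hC hU hS hq ht)

theorem permStarGraph_joinedOn_univ {k : ℕ} (hk : 0 < k) :
    (permStarGraph (k + 1)).JoinedOn Set.univ := fun u _ v _ =>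
  ((permStarGraph_isWellConnected k).reachable hk u v).mono fun _ _ h => ⟨h, trivial, trivial⟩

/-- A cluster all of whose vertices are inner vertices is connected. -/
theorem stepGraph_reachable_cluster {k : ℕ} (hk : 0 < k) {S U : Set (_ × _)} {F : Set (Sym2 _)}
    {e : Equiv.Perm (Fin (k + 1))} (hU : ∀ q, (e, q) ∈ U) (hS : ∀ q, (e, q) ∉ S)
    (u v : Equiv.Perm (Fin (k + 1))) :
    (stepGraph (hierarchicalStarGraph (k + 1)) S U F).Reachable (e, u) (e, v) :=
  stepGraph_reachable_of_joinedOn (f := fun q => (e, q))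
    (fun _ _ h => hierarchicalStarGraph_adj_inner hk h)
    (permStarGraph_joinedOn_univ hk) (fun q _ => hU q) (fun q _ => hS q) trivial trivial

/-- Three vertices in three different clusters. -/
theorem exists_steinerPacking_of_distinct_clusters {k : ℕ} (hk : 0 < k)
    {c : Fin 3 → Equiv.Perm (Fin (k + 1))} (hc : Function.Injective c)
    (p : Fin 3 → Equiv.Perm (Fin (k + 1))) :
    ∃ (W : Fin k → Set _) (F : Fin k → Set (Sym2 _)),
      IsSteinerPacking (hierarchicalStarGraph (k + 1)) (Set.range fun s => (c s, p s)) W F := by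
  classical
  -- Three different clusters force `k ≥ 2`, and then `k` further clusters remain as centres of the
  -- trees.
  have hfact : k + 3 ≤ (k + 1).factorial := by
    have h3 := Fintype.card_le_of_injective c hc
    rw [Fintype.card_perm, Fintype.card_fin, Fintype.card_fin] at h3
    have hk2 : 2 ≤ k := by
      by_contra h
      obtain rfl : k = 1 := by omega
      simp [Nat.factorial] at h3
    rw [Nat.factorial_succ]
    have h2 : 2 ≤ k.factorial := hk2.trans (Nat.self_le_factorial k)
    nlinarith
  have hcard : Fintype.card (Fin k) ≤ Fintype.card {d // d ∉ Set.range c} := by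
    rw [Fintype.card_subtype_compl, Fintype.card_perm, Fintype.card_fin, Fintype.card_fin]
    have : Fintype.card {d // d ∈ Set.range c} = 3 :=
      (Fintype.card_congr (Equiv.ofInjective c hc)).symm.trans (Fintype.card_fin 3)
    rw [this]
    omega
  obtain ⟨d⟩ := Function.Embedding.nonempty_of_card_le hcard
  have hdc : ∀ i s, (d i : Equiv.Perm (Fin (k + 1))) ≠ c s := fun i s h => (d i).2 ⟨s, h.symm⟩
  -- The vertex `(c s, d i)` is the exit from the cluster `c s` to the centre `d i`.
  have hfan := fun s => (permStarGraph_isWellConnected k).exists_fan (p s)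
    (t := fun i => (d i : Equiv.Perm (Fin (k + 1))))
    (Subtype.val_injective.comp d.injective)
  choose D hD hdisj using hfan
  refine ⟨fun i => {v | (∃ s, v.1 = c s ∧ v.2 ∈ D s i) ∨ v.1 = d i}, fun _ => ∅, ?_, ?_, ?_, ?_⟩
  · rintro i ⟨_, v⟩ (⟨s, rfl, hv⟩ | h) ⟨s', hs'⟩
    · simp only [Prod.mk.injEq] at hs' hv
      obtain rfl := hc hs'.1
      rw [← hs'.2] at hv
      exact (hD s' i).1 hv
    · exact hdc i s' (h.symm.trans (congrArg Prod.fst hs').symm)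
  · rintro i j ⟨a, v⟩ (⟨s, hs, hv⟩ | h) (⟨s', hs', hv'⟩ | h')
    · obtain rfl := hc (hs.symm.trans hs')
      exact hdisj s i j v hv hv'
    · exact absurd (h'.symm.trans hs) (hdc j s)
    · exact absurd (h.symm.trans hs') (hdc i s')
    · exact d.injective (Subtype.ext (h.symm.trans h'))
  · simp
  · intro i
    set S : Set (_ × _) := Set.range fun s => (c s, p s) with hS
    set W : Set (_ × _) := {v | (∃ s, v.1 = c s ∧ v.2 ∈ D s i) ∨ v.1 = d i} with hW
    have hdS : ∀ q, ((d i : Equiv.Perm (Fin (k + 1))), q) ∉ S := by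
      rintro q ⟨s, hs⟩
      exact hdc i s (congrArg Prod.fst hs).symm
    have hdU : ∀ q, ((d i : Equiv.Perm (Fin (k + 1))), q) ∈ W ∪ S := fun q => Or.inl (Or.inr rfl)
    have hstem := fun s => (hD s i).stepGraph_reachable (G := hierarchicalStarGraph (k + 1))
      (S := S) (U := W ∪ S) (F := ∅) (f := fun q => (c s, q))
      (fun _ _ h => hierarchicalStarGraph_adj_inner hk h) (Or.inr ⟨s, rfl⟩)
      (fun q hq => Or.inl (Or.inl ⟨s, rfl, hq⟩)) (by
        rintro q hq ⟨s', hs'⟩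
        simp only [Prod.mk.injEq] at hs'
        obtain rfl := hc hs'.1
        rw [← hs'.2] at hq
        exact (hD s' i).1 hq)
    have hbase : ∀ s, (stepGraph (hierarchicalStarGraph (k + 1)) S (W ∪ S) ∅).Reachable
        (c s, (d i : Equiv.Perm (Fin (k + 1)))) (d i, 1) := fun s =>
      (stepGraph_adj_of_notMem (hierarchicalStarGraph_adj_cross hk (hdc i s).symm) (hstem s).1
        (hdU _) (Or.inr (hdS _))).reachable.trans (stepGraph_reachable_cluster hk hdU hdS _ _)
    refine ⟨(d i, 1), ?_⟩
    rintro ⟨a, v⟩ ((⟨s, rfl, hv⟩ | rfl) | ⟨s, hs⟩)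
    · exact ((hstem s).2.2 v hv).trans (hbase s)
    · exact stepGraph_reachable_cluster hk hdU hdS _ _
    · rw [← hs]
      exact (hstem s).2.1.trans (hbase s)

theorem outerNeighbor_fst_ne {k : ℕ} (hk : 0 < k) (c p : Equiv.Perm (Fin (k + 1))) :
    (outerNeighbor c p).1 ≠ c := by
  unfold outerNeighbor
  split_ifs with h
  · exact mul_swap_last_ne hk c
  · exact h

/-- The neighbours of a vertex within a cluster lead to different clusters. -/
theorem outerNeighbor_fst_injOn {k : ℕ} (hk : 0 < k) {c p q q' : Equiv.Perm (Fin (k + 1))}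
    (hq : (permStarGraph (k + 1)).Adj p q) (hq' : (permStarGraph (k + 1)).Adj p q')
    (h : (outerNeighbor c q).1 = (outerNeighbor c q').1) : q = q' := by
  -- The only possible clash is that one neighbour is `c` itself and the other is `c * swap 0 last`;
  -- these are adjacent and would form a triangle with `p`.
  have hadj := permStarGraph_adj_swap (last_ne_zero_of_pos hk) c
  unfold outerNeighbor at h
  split_ifs at h with h1 h2 h2
  · rw [h1, h2]
  · simp only at h
    rw [h, ← h1] at hadj
    exact absurd hq' (permStarGraph_triangle_free hq hadj)
  · simp only at h
    rw [← h, ← h2] at hadj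
    exact absurd hq (permStarGraph_triangle_free hq' hadj)
  · exact h

/-- Two vertices in one cluster and a third one in another cluster. -/
theorem exists_steinerPacking_of_two_clusters {k : ℕ} (hk : 0 < k)
    {c c' p q r : Equiv.Perm (Fin (k + 1))} (hpq : p ≠ q) (hcc' : c ≠ c') :
    ∃ (W : Fin k → Set _) (F : Fin k → Set (Sym2 _)),
      IsSteinerPacking (hierarchicalStarGraph (k + 1)) {(c, p), (c, q), (c', r)} W F := by
  classical
  set w := starNeighbor p with hw
  have hwadj : ∀ i, (permStarGraph (k + 1)).Adj p (w i) := fun i =>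
    permStarGraph_adj_iff.mpr ⟨i, rfl⟩
  have hwinj : Function.Injective w := starNeighbor_injective p
  obtain ⟨D, hD, hDp, hDdisj⟩ := (permStarGraph_isWellConnected k).exists_fan_neighbors
    permStarGraph_ncard_neighbors hpq hwinj (fun v => permStarGraph_adj_iff)
  set o := fun i => outerNeighbor c (w i) with ho
  have hoc : ∀ i, (o i).1 ≠ c := fun i => outerNeighbor_fst_ne hk c (w i)
  have hoinj : ∀ i j, (o i).1 = (o j).1 → i = j := fun i j h =>
    hwinj (outerNeighbor_fst_injOn hk (hwadj i) (hwadj j) h)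
  have ho2 : ∀ i, (o i).1 = c' → (o i).2 = c ∨ (o i).2 = c' := by
    intro i hi
    simp only [ho, outerNeighbor] at hi ⊢
    split_ifs at hi ⊢ with h
    · exact Or.inr hi
    · exact Or.inl rfl
  -- The i-th tree enters the cluster `c'` at `(c', t i)`: directly if the outer edge leads there,
  -- otherwise through the cluster `(o i).1`. A direct entry has position `c` or `c'`, which no
  -- indirect one has.
  set t := fun i => if (o i).1 = c' then (o i).2 else (o i).1 with ht
  have htinj : Function.Injective t := by
    intro i j hij
    simp only [ht] at hij
    split_ifs at hij with h1 h2 h2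
    · exact hoinj i j (h1.trans h2.symm)
    · rcases ho2 i h1 with h | h
      · exact absurd (hij.symm.trans h) (hoc j)
      · exact absurd (hij.symm.trans h) h2
    · rcases ho2 j h2 with h | h
      · exact absurd (hij.trans h) (hoc i)
      · exact absurd (hij.trans h) h1
    · exact hoinj i j hij
  obtain ⟨D', hD', hD'disj⟩ := (permStarGraph_isWellConnected k).exists_fan r htinj
  have hnotS : ∀ i v, v ∈ D i → (c, v) ∉ ({(c, p), (c, q), (c', r)} : Set (_ × _)) := by
    intro i v hv hS
    simp only [Set.mem_insert_iff, Set.mem_singleton_iff, Prod.mk.injEq] at hS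
    rcases hS with ⟨-, rfl⟩ | ⟨-, rfl⟩ | ⟨h, -⟩
    · exact hDp i hv
    · exact (hD i).1 hv
    · exact hcc' h
  have hnotS' : ∀ i v, v ∈ D' i → (c', v) ∉ ({(c, p), (c, q), (c', r)} : Set (_ × _)) := by
    intro i v hv hS
    simp only [Set.mem_insert_iff, Set.mem_singleton_iff, Prod.mk.injEq] at hS
    rcases hS with ⟨h, -⟩ | ⟨h, -⟩ | ⟨-, rfl⟩
    · exact hcc' h.symm
    · exact hcc' h.symm
    · exact (hD' i).1 hv
  have hnotSo : ∀ i v, (o i).1 ≠ c' →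
      ((o i).1, v) ∉ ({(c, p), (c, q), (c', r)} : Set (_ × _)) := by
    intro i v hi hS
    simp only [Set.mem_insert_iff, Set.mem_singleton_iff, Prod.mk.injEq] at hS
    rcases hS with ⟨h, -⟩ | ⟨h, -⟩ | ⟨h, -⟩
    · exact hoc i h
    · exact hoc i h
    · exact hi h
  -- Edges inside `S` are needed only by an index with `w i = q`, possibly both from `q` to `p` and
  -- from `q` to `r`. There is at most one such index, so it may have them all.
  refine ⟨fun i => {v | (v.1 = c ∧ v.2 ∈ D i) ∨ (v.1 = c' ∧ v.2 ∈ D' i) ∨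
    (v.1 = (o i).1 ∧ (o i).1 ≠ c')}, fun i => {_e | w i = q}, ?_, ?_, ?_, ?_⟩
  · rintro i ⟨_, v⟩ (⟨rfl, hv⟩ | ⟨rfl, hv⟩ | ⟨rfl, hi⟩)
    · exact hnotS i v hv
    · exact hnotS' i v hv
    · exact hnotSo i v hi
  · rintro i j ⟨a, v⟩ (⟨h1, hv⟩ | ⟨h1, hv⟩ | ⟨h1, hi⟩) (⟨h2, hv'⟩ | ⟨h2, hv'⟩ | ⟨h2, hj⟩)
    · exact hDdisj i j v hv hv'
    · exact absurd (h1.symm.trans h2) hcc'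
    · exact absurd (h2.symm.trans h1) (hoc j)
    · exact absurd (h2.symm.trans h1) hcc'
    · exact hD'disj i j v hv hv'
    · exact absurd (h2.symm.trans h1) hj
    · exact absurd (h1.symm.trans h2) (hoc i)
    · exact absurd (h1.symm.trans h2) hi
    · exact hoinj i j (h1.symm.trans h2)
  · rintro i j e h1 h2
    exact hwinj (Eq.trans h1 (Eq.symm h2))
  · intro i
    set S : Set (_ × _) := {(c, p), (c, q), (c', r)} with hS
    set W : Set (_ × _) := {v | (v.1 = c ∧ v.2 ∈ D i) ∨ (v.1 = c' ∧ v.2 ∈ D' i) ∨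
      (v.1 = (o i).1 ∧ (o i).1 ≠ c')} with hW
    set F : Set (Sym2 (Equiv.Perm (Fin (k + 1)) × Equiv.Perm (Fin (k + 1)))) :=
      {_e | w i = q} with hF
    obtain ⟨hwU, hq, hDr⟩ := (hD i).stepGraph_reachable (G := hierarchicalStarGraph (k + 1))
      (S := S) (U := W ∪ S) (F := F) (f := fun v => (c, v))
      (fun _ _ h => hierarchicalStarGraph_adj_inner hk h) (Or.inr (by simp [hS]))
      (fun v hv => Or.inl (Or.inl ⟨rfl, hv⟩)) (hnotS i)
    obtain ⟨htU, hr, hD'r⟩ := (hD' i).stepGraph_reachable (G := hierarchicalStarGraph (k + 1))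
      (S := S) (U := W ∪ S) (F := F) (f := fun v => (c', v))
      (fun _ _ h => hierarchicalStarGraph_adj_inner hk h) (Or.inr (by simp [hS]))
      (fun v hv => Or.inl (Or.inr (Or.inl ⟨rfl, hv⟩))) (hnotS' i)
    have hwadj' : ∀ v ∈ W ∪ S, (hierarchicalStarGraph (k + 1)).Adj (c, w i) v →
        (stepGraph (hierarchicalStarGraph (k + 1)) S (W ∪ S) F).Adj (c, w i) v := by
      intro v hv h
      rcases (hD i).2 with ⟨hwq, -⟩ | ⟨hwD, -⟩
      · exact ⟨h, hwU, hv, fun _ _ => hwq⟩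
      · exact stepGraph_adj_of_notMem h hwU hv (Or.inl (hnotS i _ hwD))
    have hp : (stepGraph (hierarchicalStarGraph (k + 1)) S (W ∪ S) F).Reachable (c, p) (c, w i) :=
      (hwadj' (c, p) (Or.inr (by simp [hS]))
        (hierarchicalStarGraph_adj_inner hk (hwadj i).symm)).symm.reachable
    have houter := hierarchicalStarGraph_adj_outer hk c (w i)
    have hoU : (o i).1 ≠ c' → ∀ v, ((o i).1, v) ∈ W ∪ S := fun h v =>
      Or.inl (Or.inr (Or.inr ⟨rfl, h⟩))
    have hcl : (o i).1 ≠ c' → ∀ v,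
        (stepGraph (hierarchicalStarGraph (k + 1)) S (W ∪ S) F).Reachable ((o i).1, v)
          (c, w i) := fun h v =>
      (stepGraph_reachable_cluster hk (hoU h) (fun v => hnotSo i v h) v (o i).2).trans
        (hwadj' _ (hoU h _) houter).symm.reachable
    have hto : (stepGraph (hierarchicalStarGraph (k + 1)) S (W ∪ S) F).Reachable (c', t i)
        (c, w i) := by
      by_cases h : (o i).1 = c'
      · have e : o i = (c', t i) := Prod.ext h (by simp [ht, h])
        rw [← e] at htU ⊢
        exact (hwadj' _ htU houter).symm.reachable
      · have e : t i = (o i).1 := by simp [ht, h]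
        rw [e] at htU ⊢
        exact (stepGraph_adj_of_notMem (hierarchicalStarGraph_adj_cross hk (Ne.symm h)) htU
          (hoU h _) (Or.inr (hnotSo i _ h))).reachable.trans (hcl h c')
    refine ⟨(c, w i), ?_⟩
    rintro ⟨a, v⟩ ((⟨h1, hv⟩ | ⟨h1, hv⟩ | ⟨h1, hi⟩) | hv)
    · simp only at h1 hv
      rw [h1]
      exact hDr v hv
    · simp only at h1 hv
      rw [h1]
      exact (hD'r v hv).trans hto
    · simp only at h1
      rw [h1]
      exact hcl hi v
    · simp only [hS, Set.mem_insert_iff, Set.mem_singleton_iff] at hv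
      rcases hv with hv | hv | hv
      · rw [hv]; exact hp
      · rw [hv]; exact hq
      · rw [hv]; exact hr.trans hto

/-! ### One cluster: packings from rainbow colourings -/

/-- `s` together with its neighbours outside `S`. -/
def outwardNbhd {V : Type*} (H : SimpleGraph V) (S : Set V) (s : V) : Set V :=
  insert s {q | H.Adj s q ∧ q ∉ S}

/-- A colouring of the vertices, and an assignment of the edges inside `S` to the colours, such that
every vertex of `S` reaches every colour: inside its outward neighbourhood, without using `c`, or
after moving along an edge assigned to this colour. -/
def HasRainbowColoring {V : Type*} (H : SimpleGraph V) (k : ℕ) (S : Set V) (c : V) : Prop :=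
  ∃ (f : V → Fin k) (F : Fin k → Set (Sym2 V)), (∀ i j e, e ∈ F i → e ∈ F j → i = j) ∧
    ∀ i, ∀ s ∈ S, ∃ s' ∈ S, (s = s' ∨ (H.Adj s s' ∧ s(s, s') ∈ F i)) ∧
      ∃ q ∈ outwardNbhd H S s', q ≠ c ∧ f q = i

/-- Vertices in one cluster `c`: a rainbow colouring of the star graph gives a packing, the
`i`-th set of inner vertices containing all clusters of colour `i`. -/
theorem HasRainbowColoring.exists_steinerPacking {k : ℕ} (hk : 0 < k)
    {c : Equiv.Perm (Fin (k + 1))} {S : Set (Equiv.Perm (Fin (k + 1)))}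
    (h : HasRainbowColoring (permStarGraph (k + 1)) k S c) (hS : S.Nonempty) :
    ∃ (W : Fin k → Set _) (F : Fin k → Set (Sym2 _)),
      IsSteinerPacking (hierarchicalStarGraph (k + 1)) ((fun q => (c, q)) '' S) W F := by
  obtain ⟨f, F, hF, hsee⟩ := h
  have hinj : Function.Injective (fun q : Equiv.Perm (Fin (k + 1)) => (c, q)) :=
    fun _ _ h => congrArg Prod.snd h
  -- For `q ≠ c` the outer edge of `(c, q)` leads to the cluster `q`, which has the same colour, and
  -- clusters of one colour are pairwise joined. The outer neighbour of `(c, c)` may have another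
  -- colour, so this vertex is left out.
  refine ⟨fun i => {v | (v.1 = c ∧ v.2 ≠ c ∧ v.2 ∉ S ∧ f v.2 = i) ∨ (v.1 ≠ c ∧ f v.1 = i)},
    fun i => Sym2.map (fun q => (c, q)) '' F i, ?_, ?_, ?_, ?_⟩
  · rintro i ⟨a, v⟩ hv ⟨s, hs, he⟩
    simp only [Prod.mk.injEq] at he
    rcases hv with ⟨-, -, h, -⟩ | ⟨h, -⟩
    · exact h (he.2 ▸ hs)
    · exact h he.1.symm
  · rintro i j ⟨a, v⟩ (⟨h1, -, -, h2⟩ | ⟨h1, h2⟩) (⟨h3, -, -, h4⟩ | ⟨h3, h4⟩)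
    · exact h2.symm.trans h4
    · exact absurd h1 h3
    · exact absurd h3 h1
    · exact h2.symm.trans h4
  · rintro i j _ ⟨e, he, rfl⟩ ⟨e', he', h⟩
    exact hF i j e he (Sym2.map.injective hinj h ▸ he')
  · intro i
    set S' : Set (_ × _) := (fun q => (c, q)) '' S with hS'
    set W : Set (_ × _) := {v | (v.1 = c ∧ v.2 ≠ c ∧ v.2 ∉ S ∧ f v.2 = i) ∨
      (v.1 ≠ c ∧ f v.1 = i)} with hW
    set G' := stepGraph (hierarchicalStarGraph (k + 1)) S' (W ∪ S')
      (Sym2.map (fun q => (c, q)) '' F i) with hG'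
    have hnotS : ∀ e v, e ≠ c → (e, v) ∉ S' := by
      rintro e v he ⟨s, -, hs⟩
      exact he (congrArg Prod.fst hs).symm
    have hU : ∀ e v, e ≠ c → f e = i → (e, v) ∈ W ∪ S' := fun e v h1 h2 =>
      Or.inl (Or.inr ⟨h1, h2⟩)
    obtain ⟨b, hbc, hb⟩ : ∃ b, b ≠ c ∧ f b = i := by
      obtain ⟨s, hs⟩ := hS
      obtain ⟨-, -, -, q, -, h⟩ := hsee i s hs
      exact ⟨q, h⟩
    have hcl : ∀ e v, e ≠ c → f e = i → G'.Reachable (e, v) (b, 1) := by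
      intro e v hec he
      have hb' := stepGraph_reachable_cluster (F := Sym2.map (fun q => (c, q)) '' F i) hk
        (fun v => hU b v hbc hb) (fun v => hnotS b v hbc)
      by_cases heb : e = b
      · rw [heb]
        exact hb' v 1
      · refine (stepGraph_reachable_cluster hk
          (fun v => hU e v hec he) (fun v => hnotS e v hec) v b).trans (Reachable.trans ?_ (hb' e 1))
        exact (stepGraph_adj_of_notMem (hierarchicalStarGraph_adj_cross hk heb) (hU _ _ hec he)
          (hU _ _ hbc hb) (Or.inl (hnotS _ _ hec))).reachable
    have hport : ∀ q, q ≠ c → f q = i → (c, q) ∈ W ∪ S' → G'.Reachable (c, q) (b, 1) := by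
      intro q hqc hq hqU
      exact (stepGraph_adj_of_notMem (hierarchicalStarGraph_adj_cross hk hqc.symm) hqU
        (hU q c hqc hq) (Or.inr (hnotS q c hqc))).reachable.trans (hcl q c hqc hq)
    have hsees : ∀ s ∈ S, (∃ q ∈ outwardNbhd (permStarGraph (k + 1)) S s, q ≠ c ∧ f q = i) →
        G'.Reachable (c, s) (b, 1) := by
      rintro s hs ⟨q, rfl | ⟨hadj, hqS⟩, hqc, hq⟩
      · exact hport q hqc hq (Or.inr ⟨q, hs, rfl⟩)
      · have hqW : (c, q) ∈ W ∪ S' := Or.inl (Or.inl ⟨rfl, hqc, hqS, hq⟩)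
        have hqS' : (c, q) ∉ S' := by
          rintro ⟨s', hs', e⟩
          exact hqS (hinj e ▸ hs')
        exact (stepGraph_adj_of_notMem (hierarchicalStarGraph_adj_inner hk hadj)
          (Or.inr ⟨s, hs, rfl⟩) hqW (Or.inr hqS')).reachable.trans (hport q hqc hq hqW)
    refine ⟨(b, 1), ?_⟩
    rintro ⟨a, v⟩ ((⟨h1, h2, h3, h4⟩ | ⟨h1, h2⟩) | ⟨s, hs, he⟩)
    · simp only at h1 h2 h3 h4
      rw [h1]
      exact hport v h2 h4 (Or.inl (Or.inl ⟨rfl, h2, h3, h4⟩))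
    · exact hcl a v h1 h2
    · rw [← he]
      obtain ⟨s', hs', rfl | ⟨hadj, hF'⟩, hq⟩ := hsee i s hs
      · exact hsees s hs hq
      · refine Reachable.trans (Adj.reachable ?_) (hsees s' hs' hq)
        exact ⟨hierarchicalStarGraph_adj_inner hk hadj, Or.inr ⟨s, hs, rfl⟩,
          Or.inr ⟨s', hs', rfl⟩, fun _ _ => ⟨s(s, s'), hF', rfl⟩⟩

/-! ### Existence of rainbow colourings -/

section Coloring

variable {V : Type*} {k : ℕ}

/-- `f` attains on `L` every colour in `K`. -/
def Covers (f : V → Fin k) (L : Set V) (K : Set (Fin k)) : Prop :=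
  ∀ i ∈ K, ∃ q ∈ L, f q = i

theorem exists_covers [Finite V] (hk : 0 < k) {L : Set V} {K : Set (Fin k)} (h : K.ncard ≤ L.ncard) :
    ∃ f : V → Fin k, Covers f L K := by
  classical
  obtain ⟨L', hL', hcard⟩ := Set.exists_subset_card_eq h
  have hcard' : Nat.card L' = Nat.card K := hcard
  let e : L' ≃ K := (Finite.card_eq.mp hcard').some
  refine ⟨fun q => if hq : q ∈ L' then e ⟨q, hq⟩ else ⟨0, hk⟩, fun i hi => ?_⟩
  refine ⟨e.symm ⟨i, hi⟩, hL' (e.symm ⟨i, hi⟩).2, ?_⟩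
  simp

/-- The clause on agreement with `f₂` off `L₁` lets a third list survive the recolouring. -/
theorem exists_covers_pair {L₁ L₂ : Set V} {K₁ K₂ : Set (Fin k)} (hd : ∀ q ∈ L₁, q ∉ L₂)
    {f₁ f₂ : V → Fin k} (h₁ : Covers f₁ L₁ K₁) (h₂ : Covers f₂ L₂ K₂) :
    ∃ f : V → Fin k, (∀ q ∉ L₁, f q = f₂ q) ∧ Covers f L₁ K₁ ∧
      Covers f L₂ K₂ := by
  classical
  refine ⟨fun q => if q ∈ L₁ then f₁ q else f₂ q, fun q hq => if_neg hq,
    fun i hi => ?_, fun i hi => ?_⟩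
  · obtain ⟨q, hq, h⟩ := h₁ i hi
    exact ⟨q, hq, (if_pos hq).trans h⟩
  · obtain ⟨q, hq, h⟩ := h₂ i hi
    exact ⟨q, hq, (if_neg fun hq' => hd q hq' hq).trans h⟩

theorem exists_covers_triple_of_disjoint [Finite V] (hk : 0 < k) {L₁ L₂ L₃ : Set V}
    {K₁ K₂ K₃ : Set (Fin k)} (h₁ : K₁.ncard ≤ L₁.ncard) (h₂ : K₂.ncard ≤ L₂.ncard) (h₃ : K₃.ncard ≤ L₃.ncard)
    (h12 : ∀ q ∈ L₁, q ∉ L₂) (h13 : ∀ q ∈ L₁, q ∉ L₃) (h23 : ∀ q ∈ L₂, q ∉ L₃) :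
    ∃ f : V → Fin k, Covers f L₁ K₁ ∧ Covers f L₂ K₂ ∧ Covers f L₃ K₃ := by
  obtain ⟨f₁, hf₁⟩ := exists_covers hk h₁
  obtain ⟨f₂, hf₂⟩ := exists_covers hk h₂
  obtain ⟨f₃, hf₃⟩ := exists_covers hk h₃
  obtain ⟨g, -, hg2, hg3⟩ := exists_covers_pair h23 hf₂ hf₃
  obtain ⟨f, hf, hf1, hf2⟩ := exists_covers_pair h12 hf₁ hg2
  refine ⟨f, hf1, hf2, fun i hi => ?_⟩
  obtain ⟨q, hq, h⟩ := hg3 i hi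
  exact ⟨q, hq, (hf q fun hq' => h13 q hq' hq).trans h⟩

/-- A vertex shared by `L₂` and `L₃` gives one colour to both. Without it the lists are disjoint,
and these two have one vertex and one colour fewer to match. -/
theorem exists_covers_triple [Finite V] (hk : 0 < k) {L₁ L₂ L₃ : Set V} {K₁ : Set (Fin k)}
    (h₁ : K₁.ncard ≤ L₁.ncard) (h₂ : k ≤ L₂.ncard) (h₃ : k ≤ L₃.ncard)
    (h12 : ∀ q ∈ L₁, q ∉ L₂) (h13 : ∀ q ∈ L₁, q ∉ L₃)
    (h23 : ∀ q ∈ L₂, q ∈ L₃ → ∀ q' ∈ L₂, q' ∈ L₃ → q = q') :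
    ∃ f : V → Fin k, Covers f L₁ K₁ ∧ Covers f L₂ Set.univ ∧ Covers f L₃ Set.univ := by
  classical
  by_cases hv : ∃ v ∈ L₂, v ∈ L₃
  · obtain ⟨v, hv2, hv3⟩ := hv
    have hcol : ∀ L : Set V, k ≤ L.ncard → v ∈ L →
        ({(⟨0, hk⟩ : Fin k)}ᶜ : Set (Fin k)).ncard ≤ (L \ {v}).ncard := by
      intro L hL hvL
      rw [Set.ncard_compl, Set.ncard_singleton, Nat.card_eq_fintype_card, Fintype.card_fin,
        Set.ncard_sdiff_singleton_of_mem hvL]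
      omega
    obtain ⟨f, hf1, hf2, hf3⟩ := exists_covers_triple_of_disjoint hk h₁ (hcol L₂ h₂ hv2)
      (hcol L₃ h₃ hv3) (fun q hq h => h12 q hq h.1) (fun q hq h => h13 q hq h.1)
      (fun q hq h => hq.2 (h23 q hq.1 h.1 v hv2 hv3))
    have hupd : ∀ q, q ≠ v → Function.update f v ⟨0, hk⟩ q = f q := fun q hq =>
      Function.update_of_ne hq _ _
    have hfin : ∀ L : Set V, v ∈ L → Covers f (L \ {v}) {(⟨0, hk⟩ : Fin k)}ᶜ →
        Covers (Function.update f v ⟨0, hk⟩) L Set.univ := by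
      intro L hvL hL i _
      by_cases hi : i = ⟨0, hk⟩
      · exact ⟨v, hvL, by rw [hi, Function.update_self]⟩
      · obtain ⟨q, hq, h⟩ := hL i hi
        exact ⟨q, hq.1, (hupd q hq.2).trans h⟩
    refine ⟨Function.update f v ⟨0, hk⟩, fun i hi => ?_, hfin L₂ hv2 hf2, hfin L₃ hv3 hf3⟩
    obtain ⟨q, hq, h⟩ := hf1 i hi
    exact ⟨q, hq, (hupd q fun e => h12 q hq (e ▸ hv2)).trans h⟩
  · push Not at hv
    exact exists_covers_triple_of_disjoint hk h₁ (by simpa [Set.ncard_univ] using h₂)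
      (by simpa [Set.ncard_univ] using h₃) h12 h13 hv

variable {H : SimpleGraph V}

theorem outwardNbhd_inter {S : Set V} {s s' q : V} (hs : s ∈ S) (hs' : s' ∈ S) (hne : s ≠ s')
    (h : q ∈ outwardNbhd H S s) (h' : q ∈ outwardNbhd H S s') :
    H.Adj s q ∧ H.Adj s' q ∧ q ∉ S := by
  rcases h with rfl | ⟨h1, h2⟩
  · rcases h' with h' | ⟨-, h'⟩
    · exact absurd h' hne
    · exact absurd hs h'
  · rcases h' with rfl | ⟨h', -⟩
    · exact absurd hs' h2
    · exact ⟨h1, h', h2⟩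

/-- The vertex itself counts along with its `k` neighbours, and each neighbour inside `S` costs one.
-/
theorem ncard_outwardNbhd [Finite V] (hreg : ∀ v, {w | H.Adj v w}.ncard = k) {S : Set V} {s : V}
    (hs : s ∈ S) (A : Set V) (hA : ∀ v, v ∈ S ∧ H.Adj s v ↔ v ∈ A) :
    (outwardNbhd H S s).ncard + A.ncard = k + 1 := by
  have h1 : {q | H.Adj s q ∧ q ∉ S} = {q | H.Adj s q} \ A := by
    ext q
    have := hA q
    simp only [Set.mem_ofPred_eq, Set.mem_sdiff]
    tauto
  have hAsub : A ⊆ {q | H.Adj s q} := fun q hq => ((hA q).mpr hq).2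
  unfold outwardNbhd
  rw [Set.ncard_insert_of_notMem (fun h => h.2 hs) (Set.toFinite _), h1,
    Set.ncard_sdiff hAsub (Set.toFinite _), hreg]
  have := Set.ncard_le_ncard hAsub (Set.toFinite _)
  rw [hreg] at this
  omega

theorem le_ncard_sdiff_of_subsingleton [Finite V] {A B : Set V} {m : ℕ} (hA : m + 1 ≤ A.ncard)
    (h : ∀ q ∈ A, q ∈ B → ∀ q' ∈ A, q' ∈ B → q = q') : m ≤ (A \ B).ncard := by
  have h1 : (A ∩ B).ncard ≤ 1 := (Set.ncard_le_one (Set.toFinite _)).mpr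
    fun a ha b hb => h a ha.1 ha.2 b hb.1 hb.2
  have h2 := Set.ncard_inter_add_ncard_sdiff_eq_ncard A B (Set.toFinite _)
  omega

theorem le_ncard_sdiff_singleton [Finite V] {A : Set V} {m : ℕ} (hA : m + 1 ≤ A.ncard) (c : V) :
    m ≤ (A \ {c}).ncard :=
  le_ncard_sdiff_of_subsingleton hA fun _ _ h _ _ h' => Eq.trans h (Eq.symm h')

theorem ncard_compl_singleton_fin (a : Fin k) : ({a}ᶜ : Set (Fin k)).ncard = k - 1 := by
  rw [Set.ncard_compl, Set.ncard_singleton, Nat.card_eq_fintype_card, Fintype.card_fin]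

/-- Each outward neighbourhood has `k + 1` elements, one to spare. At `x` the spare pays for
avoiding `c`; at `y` and `z` it pays for avoiding the neighbourhood of `x`. -/
theorem hasRainbowColoring_of_independent [Finite V] (hk : 0 < k)
    (hreg : ∀ v, {w | H.Adj v w}.ncard = k)
    (hcn : ∀ p q r s, p ≠ q → H.Adj p r → H.Adj q r → H.Adj p s → H.Adj q s → r = s)
    {x y z c : V} (hxy : x ≠ y) (hxz : x ≠ z) (hyz : y ≠ z)
    (axy : ¬ H.Adj x y) (axz : ¬ H.Adj x z) (ayz : ¬ H.Adj y z)
    (hc : c ∈ outwardNbhd H {x, y, z} x ∨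
      (c ∉ outwardNbhd H {x, y, z} y ∧ c ∉ outwardNbhd H {x, y, z} z)) :
    HasRainbowColoring H k {x, y, z} c := by
  set S : Set V := {x, y, z} with hS
  have hxS : x ∈ S := by simp [hS]
  have hyS : y ∈ S := by simp [hS]
  have hzS : z ∈ S := by simp [hS]
  have card : ∀ s ∈ S, (outwardNbhd H S s).ncard = k + 1 := by
    intro s hs
    have := ncard_outwardNbhd hreg hs ∅ (by
      intro v
      simp only [hS, Set.mem_insert_iff, Set.mem_singleton_iff, Set.mem_empty_iff_false,
        iff_false, not_and] at hs ⊢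
      rcases hs with rfl | rfl | rfl <;> rintro (rfl | rfl | rfl) <;>
        first | exact H.irrefl | assumption | (intro h; exact absurd h.symm (by assumption)))
    simpa using this
  have inter : ∀ s ∈ S, ∀ s' ∈ S, s ≠ s' → ∀ q ∈ outwardNbhd H S s, q ∈ outwardNbhd H S s' →
      ∀ q' ∈ outwardNbhd H S s, q' ∈ outwardNbhd H S s' → q = q' := by
    intro s hs s' hs' hne q h1 h2 q' h3 h4
    have e1 := outwardNbhd_inter hs hs' hne h1 h2
    have e2 := outwardNbhd_inter hs hs' hne h3 h4
    exact hcn s s' q q' hne e1.1 e1.2.1 e2.1 e2.2.1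
  obtain ⟨f, h1, h2, h3⟩ := exists_covers_triple (k := k) (L₁ := outwardNbhd H S x \ {c})
    (L₂ := outwardNbhd H S y \ outwardNbhd H S x) (L₃ := outwardNbhd H S z \ outwardNbhd H S x)
    (K₁ := Set.univ) hk (by
      rw [Set.ncard_univ, Nat.card_eq_fintype_card, Fintype.card_fin]
      exact le_ncard_sdiff_singleton (card x hxS).ge c)
    (le_ncard_sdiff_of_subsingleton (card y hyS).ge (inter y hyS x hxS hxy.symm))
    (le_ncard_sdiff_of_subsingleton (card z hzS).ge (inter z hzS x hxS hxz.symm))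
    (fun q hq hq' => hq'.2 hq.1) (fun q hq hq' => hq'.2 hq.1)
    (fun q hq hq' q' h h' => inter y hyS z hzS hyz q hq.1 hq'.1 q' h.1 h'.1)
  refine ⟨f, fun _ => ∅, by simp, fun i s hs => ⟨s, hs, Or.inl rfl, ?_⟩⟩
  simp only [hS, Set.mem_insert_iff, Set.mem_singleton_iff] at hs
  rcases hs with rfl | rfl | rfl
  · obtain ⟨q, hq, hqi⟩ := h1 i trivial
    exact ⟨q, hq.1, hq.2, hqi⟩
  · obtain ⟨q, hq, hqi⟩ := h2 i trivial
    refine ⟨q, hq.1, ?_, hqi⟩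
    rintro rfl
    exact hc.elim hq.2 fun h => h.1 hq.1
  · obtain ⟨q, hq, hqi⟩ := h3 i trivial
    refine ⟨q, hq.1, ?_, hqi⟩
    rintro rfl
    exact hc.elim hq.2 fun h => h.2 hq.1

/-- The neighbourhoods of `x` and `y` are disjoint with `k` elements each. The vertex `x` gets
colour `0` through the edge `xy`, so it has one element to spare, as `z` has; `y` needs all of its
own. -/
theorem hasRainbowColoring_of_edge [Finite V] (hk : 0 < k) (hreg : ∀ v, {w | H.Adj v w}.ncard = k)
    (htri : ∀ p q r, H.Adj p q → H.Adj q r → ¬ H.Adj p r)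
    (hcn : ∀ p q r s, p ≠ q → H.Adj p r → H.Adj q r → H.Adj p s → H.Adj q s → r = s)
    {x y z c : V} (hxz : x ≠ z) (hyz : y ≠ z)
    (axy : H.Adj x y) (axz : ¬ H.Adj x z) (ayz : ¬ H.Adj y z)
    (hc : c ∈ outwardNbhd H {x, y, z} x ∨ c ∉ outwardNbhd H {x, y, z} y) :
    HasRainbowColoring H k {x, y, z} c := by
  set S : Set V := {x, y, z} with hS
  have hxy : x ≠ y := axy.ne
  have hxS : x ∈ S := by simp [hS]
  have hyS : y ∈ S := by simp [hS]
  have hzS : z ∈ S := by simp [hS]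
  have cardx : (outwardNbhd H S x).ncard = k := by
    have := ncard_outwardNbhd hreg hxS {y} (by
      intro v
      simp only [hS, Set.mem_insert_iff, Set.mem_singleton_iff]
      constructor
      · rintro ⟨rfl | rfl | rfl, h⟩
        · exact absurd h H.irrefl
        · rfl
        · exact absurd h axz
      · rintro rfl; exact ⟨by simp, axy⟩)
    simpa using this
  have cardy : (outwardNbhd H S y).ncard = k := by
    have := ncard_outwardNbhd hreg hyS {x} (by
      intro v
      simp only [hS, Set.mem_insert_iff, Set.mem_singleton_iff]
      constructor
      · rintro ⟨rfl | rfl | rfl, h⟩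
        · rfl
        · exact absurd h H.irrefl
        · exact absurd h ayz
      · rintro rfl; exact ⟨by simp, axy.symm⟩)
    simpa using this
  have cardz : (outwardNbhd H S z).ncard = k + 1 := by
    have := ncard_outwardNbhd hreg hzS ∅ (by
      intro v
      simp only [hS, Set.mem_insert_iff, Set.mem_singleton_iff, Set.mem_empty_iff_false, iff_false]
      rintro ⟨rfl | rfl | rfl, h⟩
      · exact absurd h.symm axz
      · exact absurd h.symm ayz
      · exact absurd h H.irrefl)
    simpa using this
  have inter : ∀ s ∈ S, ∀ s' ∈ S, s ≠ s' → ∀ q ∈ outwardNbhd H S s, q ∈ outwardNbhd H S s' →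
      ∀ q' ∈ outwardNbhd H S s, q' ∈ outwardNbhd H S s' → q = q' := by
    intro s hs s' hs' hne q h1 h2 q' h3 h4
    have e1 := outwardNbhd_inter hs hs' hne h1 h2
    have e2 := outwardNbhd_inter hs hs' hne h3 h4
    exact hcn s s' q q' hne e1.1 e1.2.1 e2.1 e2.2.1
  have dxy : ∀ q ∈ outwardNbhd H S x, q ∉ outwardNbhd H S y := fun q h1 h2 =>
    have e := outwardNbhd_inter hxS hyS hxy h1 h2
    htri x y q axy e.2.1 e.1
  obtain ⟨L₁, L₂, L₃, hL₁, hL₂, hL₃, hc₁, hc₂, hc₃, f, h1, h2, h3⟩ :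
      ∃ L₁ L₂ L₃, L₁ ⊆ outwardNbhd H S x ∧ L₂ ⊆ outwardNbhd H S y ∧ L₃ ⊆ outwardNbhd H S z ∧
        c ∉ L₁ ∧ c ∉ L₂ ∧ c ∉ L₃ ∧ ∃ f : V → Fin k, Covers f L₁ {(⟨0, hk⟩ : Fin k)}ᶜ ∧
          Covers f L₂ Set.univ ∧ Covers f L₃ Set.univ := by
    by_cases hcx : c ∈ outwardNbhd H S x
    · refine ⟨outwardNbhd H S x \ {c}, outwardNbhd H S y, outwardNbhd H S z \ outwardNbhd H S x,
        Set.sdiff_subset, subset_rfl, Set.sdiff_subset, fun h => h.2 rfl, dxy c hcx,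
        fun h => h.2 hcx, ?_⟩
      refine exists_covers_triple hk ?_ cardy.ge
        (le_ncard_sdiff_of_subsingleton cardz.ge (inter z hzS x hxS hxz.symm))
        (fun q hq hq' => dxy q hq.1 hq') (fun q hq hq' => hq'.2 hq.1)
        (fun q hq hq' q' h h' => inter y hyS z hzS hyz q hq hq'.1 q' h h'.1)
      rw [ncard_compl_singleton_fin]
      exact le_ncard_sdiff_singleton (by omega) c
    · refine ⟨outwardNbhd H S x \ outwardNbhd H S z, outwardNbhd H S y, outwardNbhd H S z \ {c},
        Set.sdiff_subset, subset_rfl, Set.sdiff_subset, fun h => hcx h.1, hc.resolve_left hcx,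
        fun h => h.2 rfl, ?_⟩
      refine exists_covers_triple hk ?_ cardy.ge (le_ncard_sdiff_singleton cardz.ge c)
        (fun q hq hq' => dxy q hq.1 hq') (fun q hq hq' => hq.2 hq'.1)
        (fun q hq hq' q' h h' => inter y hyS z hzS hyz q hq hq'.1 q' h h'.1)
      rw [ncard_compl_singleton_fin]
      exact le_ncard_sdiff_of_subsingleton (by omega) (inter x hxS z hzS hxz)
  refine ⟨f, fun i => {_e | i = ⟨0, hk⟩}, fun i j _ hi hj => Eq.trans hi (Eq.symm hj),
    fun i s hs => ?_⟩
  have seey : ∃ q ∈ outwardNbhd H S y, q ≠ c ∧ f q = i := by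
    obtain ⟨q, hq, hqi⟩ := h2 i trivial
    exact ⟨q, hL₂ hq, fun e => hc₂ (e ▸ hq), hqi⟩
  simp only [hS, Set.mem_insert_iff, Set.mem_singleton_iff] at hs
  rcases hs with rfl | rfl | rfl
  · by_cases hi : i = ⟨0, hk⟩
    · exact ⟨y, hyS, Or.inr ⟨axy, hi⟩, seey⟩
    · obtain ⟨q, hq, hqi⟩ := h1 i hi
      exact ⟨s, hxS, Or.inl rfl, q, hL₁ hq, fun e => hc₁ (e ▸ hq), hqi⟩
  · exact ⟨s, hyS, Or.inl rfl, seey⟩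
  · obtain ⟨q, hq, hqi⟩ := h3 i trivial
    exact ⟨s, hzS, Or.inl rfl, q, hL₃ hq, fun e => hc₃ (e ▸ hq), hqi⟩

/-- The neighbourhoods are disjoint, with `k`, `k - 1` and `k` elements. If `c` is seen from `x`,
then `x` borrows a colour from `y` and `y` one from `z`. Otherwise `y` borrows one from each end and
can afford to lose `c`. -/
theorem hasRainbowColoring_of_path [Finite V] (hk : 1 < k) (hreg : ∀ v, {w | H.Adj v w}.ncard = k)
    (htri : ∀ p q r, H.Adj p q → H.Adj q r → ¬ H.Adj p r)
    (hcn : ∀ p q r s, p ≠ q → H.Adj p r → H.Adj q r → H.Adj p s → H.Adj q s → r = s)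
    {x y z c : V} (hxz : x ≠ z) (axy : H.Adj x y) (ayz : H.Adj y z)
    (hc : c ∈ outwardNbhd H {x, y, z} x ∨ c ∉ outwardNbhd H {x, y, z} z) :
    HasRainbowColoring H k {x, y, z} c := by
  set S : Set V := {x, y, z} with hS
  have hxy : x ≠ y := axy.ne
  have hyz : y ≠ z := ayz.ne
  have hxS : x ∈ S := by simp [hS]
  have hyS : y ∈ S := by simp [hS]
  have hzS : z ∈ S := by simp [hS]
  have axz := htri x y z axy ayz
  have cardx : (outwardNbhd H S x).ncard = k := by
    have := ncard_outwardNbhd hreg hxS {y} (by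
      intro v
      simp only [hS, Set.mem_insert_iff, Set.mem_singleton_iff]
      constructor
      · rintro ⟨rfl | rfl | rfl, h⟩
        · exact absurd h H.irrefl
        · rfl
        · exact absurd h axz
      · rintro rfl; exact ⟨by simp, axy⟩)
    simpa using this
  have cardz : (outwardNbhd H S z).ncard = k := by
    have := ncard_outwardNbhd hreg hzS {y} (by
      intro v
      simp only [hS, Set.mem_insert_iff, Set.mem_singleton_iff]
      constructor
      · rintro ⟨rfl | rfl | rfl, h⟩
        · exact absurd h.symm axz
        · rfl
        · exact absurd h H.irrefl
      · rintro rfl; exact ⟨by simp, ayz.symm⟩)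
    simpa using this
  have cardy : (outwardNbhd H S y).ncard + 1 = k := by
    have := ncard_outwardNbhd hreg hyS {x, z} (by
      intro v
      simp only [hS, Set.mem_insert_iff, Set.mem_singleton_iff]
      constructor
      · rintro ⟨rfl | rfl | rfl, h⟩
        · exact Or.inl rfl
        · exact absurd h H.irrefl
        · exact Or.inr rfl
      · rintro (rfl | rfl)
        · exact ⟨by simp, axy.symm⟩
        · exact ⟨by simp, ayz⟩)
    rw [Set.ncard_pair hxz] at this
    omega
  have dxy : ∀ q ∈ outwardNbhd H S x, q ∉ outwardNbhd H S y := fun q h1 h2 =>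
    have e := outwardNbhd_inter hxS hyS hxy h1 h2
    htri x y q axy e.2.1 e.1
  have dyz : ∀ q ∈ outwardNbhd H S y, q ∉ outwardNbhd H S z := fun q h1 h2 =>
    have e := outwardNbhd_inter hyS hzS hyz h1 h2
    htri y z q ayz e.2.1 e.1
  have dxz : ∀ q ∈ outwardNbhd H S x, q ∉ outwardNbhd H S z := fun q h1 h2 =>
    have e := outwardNbhd_inter hxS hzS hxz h1 h2
    e.2.2 (hcn x z q y hxz e.1 e.2.1 axy ayz.symm ▸ hyS)
  set a : Fin k := ⟨0, by omega⟩ with ha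
  set b : Fin k := ⟨1, hk⟩ with hb
  have hab : a ≠ b := by simp [ha, hb]
  have hFdisj : ∀ i j e, e ∈ {e | (i = a ∧ e = s(x, y)) ∨ (i = b ∧ e = s(y, z))} →
      e ∈ {e | (j = a ∧ e = s(x, y)) ∨ (j = b ∧ e = s(y, z))} → i = j := by
    have hne : s(x, y) ≠ s(y, z) := by
      intro h
      rcases Sym2.eq_iff.mp h with h | h
      · exact hxy h.1
      · exact hxz h.1
    rintro i j e (⟨rfl, h1⟩ | ⟨rfl, h1⟩) (⟨rfl, h2⟩ | ⟨rfl, h2⟩)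
    · rfl
    · exact absurd (h1.symm.trans h2) hne
    · exact absurd (h2.symm.trans h1) hne
    · rfl
  by_cases hcx : c ∈ outwardNbhd H S x
  · obtain ⟨f, h1, h2, h3⟩ := exists_covers_triple_of_disjoint (k := k)
      (L₁ := outwardNbhd H S x \ {c}) (L₂ := outwardNbhd H S y) (L₃ := outwardNbhd H S z)
      (K₁ := {a}ᶜ) (K₂ := {b}ᶜ) (K₃ := Set.univ) (by omega)
      (by rw [ncard_compl_singleton_fin]; exact le_ncard_sdiff_singleton (by omega) c)
      (by rw [ncard_compl_singleton_fin]; omega)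
      (by rw [Set.ncard_univ, Nat.card_eq_fintype_card, Fintype.card_fin]; omega)
      (fun q hq => dxy q hq.1) (fun q hq => dxz q hq.1) dyz
    refine ⟨f, fun i => {e | (i = a ∧ e = s(x, y)) ∨ (i = b ∧ e = s(y, z))}, hFdisj,
      fun i s hs => ?_⟩
    have seey : i ≠ b → ∃ q ∈ outwardNbhd H S y, q ≠ c ∧ f q = i := by
      intro hi
      obtain ⟨q, hq, hqi⟩ := h2 i hi
      exact ⟨q, hq, fun e => dxy c hcx (e ▸ hq), hqi⟩
    have seez : ∃ q ∈ outwardNbhd H S z, q ≠ c ∧ f q = i := by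
      obtain ⟨q, hq, hqi⟩ := h3 i trivial
      exact ⟨q, hq, fun e => dxz c hcx (e ▸ hq), hqi⟩
    simp only [hS, Set.mem_insert_iff, Set.mem_singleton_iff] at hs
    rcases hs with rfl | rfl | rfl
    · by_cases hi : i = a
      · exact ⟨y, hyS, Or.inr ⟨axy, Or.inl ⟨hi, rfl⟩⟩, seey (hi ▸ hab)⟩
      · obtain ⟨q, hq, hqi⟩ := h1 i hi
        exact ⟨s, hxS, Or.inl rfl, q, hq.1, hq.2, hqi⟩
    · by_cases hi : i = b
      · exact ⟨z, hzS, Or.inr ⟨ayz, Or.inr ⟨hi, rfl⟩⟩, seez⟩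
      · exact ⟨s, hyS, Or.inl rfl, seey hi⟩
    · exact ⟨s, hzS, Or.inl rfl, seez⟩
  · have hcz := hc.resolve_left hcx
    obtain ⟨f, h1, h2, h3⟩ := exists_covers_triple_of_disjoint (k := k)
      (L₁ := outwardNbhd H S x) (L₂ := outwardNbhd H S y \ {c}) (L₃ := outwardNbhd H S z)
      (K₁ := Set.univ) (K₂ := {a, b}ᶜ) (K₃ := Set.univ) (by omega)
      (by rw [Set.ncard_univ, Nat.card_eq_fintype_card, Fintype.card_fin]; omega)
      (by
        rw [Set.ncard_compl, Set.ncard_pair hab, Nat.card_eq_fintype_card, Fintype.card_fin]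
        exact le_ncard_sdiff_singleton (by omega) c)
      (by rw [Set.ncard_univ, Nat.card_eq_fintype_card, Fintype.card_fin]; omega)
      (fun q hq h => dxy q hq h.1) dxz (fun q hq => dyz q hq.1)
    refine ⟨f, fun i => {e | (i = a ∧ e = s(x, y)) ∨ (i = b ∧ e = s(y, z))}, hFdisj,
      fun i s hs => ?_⟩
    have seex : ∃ q ∈ outwardNbhd H S x, q ≠ c ∧ f q = i := by
      obtain ⟨q, hq, hqi⟩ := h1 i trivial
      exact ⟨q, hq, fun e => hcx (e ▸ hq), hqi⟩
    have seez : ∃ q ∈ outwardNbhd H S z, q ≠ c ∧ f q = i := by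
      obtain ⟨q, hq, hqi⟩ := h3 i trivial
      exact ⟨q, hq, fun e => hcz (e ▸ hq), hqi⟩
    simp only [hS, Set.mem_insert_iff, Set.mem_singleton_iff] at hs
    rcases hs with rfl | rfl | rfl
    · exact ⟨s, hxS, Or.inl rfl, seex⟩
    · by_cases hi : i = a
      · exact ⟨x, hxS, Or.inr ⟨axy.symm, Or.inl ⟨hi, Sym2.eq_swap⟩⟩, seex⟩
      · by_cases hi' : i = b
        · exact ⟨z, hzS, Or.inr ⟨ayz, Or.inr ⟨hi', rfl⟩⟩, seez⟩
        · obtain ⟨q, hq, hqi⟩ := h2 i (by simp [hi, hi'])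
          exact ⟨s, hyS, Or.inl rfl, q, hq.1, hq.2, hqi⟩
    · exact ⟨s, hzS, Or.inl rfl, seez⟩

/-- A triangle-free and quadrangle-free `k`-regular graph, `k ≥ 2`, has rainbow colourings for any
three vertices. -/
theorem hasRainbowColoring [Finite V] (hk : 1 < k) (hreg : ∀ v, {w | H.Adj v w}.ncard = k)
    (htri : ∀ p q r, H.Adj p q → H.Adj q r → ¬ H.Adj p r)
    (hcn : ∀ p q r s, p ≠ q → H.Adj p r → H.Adj q r → H.Adj p s → H.Adj q s → r = s)
    {x y z : V} (c : V) (hxy : x ≠ y) (hxz : x ≠ z) (hyz : y ≠ z) :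
    HasRainbowColoring H k {x, y, z} c := by
  have hk0 : 0 < k := by omega
  have path : ∀ x y z : V, x ≠ z → H.Adj x y → H.Adj y z →
      HasRainbowColoring H k {x, y, z} c := by
    intro x y z hxz axy ayz
    -- The path is reversed if necessary, so that its first vertex sees `c` or its last one does
    -- not.
    by_cases h : c ∈ outwardNbhd H {x, y, z} z
    · have e : ({x, y, z} : Set V) = {z, y, x} := by ext; simp; tauto
      rw [e] at h ⊢
      exact hasRainbowColoring_of_path hk hreg htri hcn hxz.symm ayz.symm axy.symm (Or.inl h)
    · exact hasRainbowColoring_of_path hk hreg htri hcn hxz axy ayz (Or.inr h)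
  have edge : ∀ x y z : V, x ≠ z → y ≠ z → H.Adj x y → HasRainbowColoring H k {x, y, z} c := by
    intro x y z hxz hyz axy
    have e : ({x, y, z} : Set V) = {y, x, z} := by ext; simp; tauto
    by_cases ayz : H.Adj y z
    · exact path x y z hxz axy ayz
    by_cases axz : H.Adj x z
    · rw [e]
      exact path y x z hyz axy.symm axz
    by_cases h : c ∈ outwardNbhd H {x, y, z} y
    · rw [e] at h ⊢
      exact hasRainbowColoring_of_edge hk0 hreg htri hcn hyz hxz axy.symm ayz axz (Or.inl h)
    · exact hasRainbowColoring_of_edge hk0 hreg htri hcn hxz hyz axy axz ayz (Or.inr h)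
  have e1 : ({x, y, z} : Set V) = {x, z, y} := by ext; simp; tauto
  have e2 : ({x, y, z} : Set V) = {y, z, x} := by ext; simp; tauto
  have e3 : ({x, y, z} : Set V) = {y, x, z} := by ext; simp; tauto
  have e4 : ({x, y, z} : Set V) = {z, x, y} := by ext; simp; tauto
  by_cases axy : H.Adj x y
  · exact edge x y z hxz hyz axy
  by_cases axz : H.Adj x z
  · exact e1 ▸ edge x z y hxy hyz.symm axz
  by_cases ayz : H.Adj y z
  · exact e2 ▸ edge y z x hxy.symm hxz.symm ayz
  have axy' : ¬ H.Adj y x := fun h => axy h.symm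
  have axz' : ¬ H.Adj z x := fun h => axz h.symm
  have ayz' : ¬ H.Adj z y := fun h => ayz h.symm
  by_cases hy : c ∈ outwardNbhd H {x, y, z} y
  · rw [e3] at hy ⊢
    exact hasRainbowColoring_of_independent hk0 hreg hcn hxy.symm hyz hxz axy' ayz axz (Or.inl hy)
  by_cases hz : c ∈ outwardNbhd H {x, y, z} z
  · rw [e4] at hz ⊢
    exact hasRainbowColoring_of_independent hk0 hreg hcn hxz.symm hyz.symm hxy axz' ayz' axy
      (Or.inl hz)
  · exact hasRainbowColoring_of_independent hk0 hreg hcn hxy hxz hyz axy axz ayz (Or.inr ⟨hy, hz⟩)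

end Coloring

/-! ### All triples, and the theorem -/

/-- Any three vertices of the hierarchical star graph admit a packing of `k` trees. -/
theorem exists_steinerPacking_hierarchicalStarGraph {k : ℕ} (hk : 0 < k)
    {x y z : Equiv.Perm (Fin (k + 1)) × Equiv.Perm (Fin (k + 1))}
    (hxy : x ≠ y) (hxz : x ≠ z) (hyz : y ≠ z) :
    ∃ (W : Fin k → Set _) (F : Fin k → Set (Sym2 _)),
      IsSteinerPacking (hierarchicalStarGraph (k + 1)) {x, y, z} W F := by
  obtain ⟨c₁, p₁⟩ := x
  obtain ⟨c₂, p₂⟩ := y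
  obtain ⟨c₃, p₃⟩ := z
  by_cases h12 : c₁ = c₂
  · subst h12
    have hp : p₁ ≠ p₂ := fun h => hxy (h ▸ rfl)
    by_cases h13 : c₁ = c₃
    · subst h13
      have hp' : p₁ ≠ p₃ := fun h => hxz (h ▸ rfl)
      have hp'' : p₂ ≠ p₃ := fun h => hyz (h ▸ rfl)
      -- A cluster has only two vertices when `k = 1`. Two colours are needed when the three
      -- vertices form a path.
      have hk2 : 1 < k := by
        by_contra h
        obtain rfl : k = 1 := by omega
        have h1 := Finset.card_le_univ ({p₁, p₂, p₃} : Finset (Equiv.Perm (Fin (1 + 1))))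
        rw [Finset.card_eq_three.mpr ⟨p₁, p₂, p₃, hp, hp', hp'', rfl⟩, Fintype.card_perm] at h1
        simp at h1
      have := (hasRainbowColoring hk2 permStarGraph_ncard_neighbors
        (fun _ _ _ => permStarGraph_triangle_free)
        (fun _ _ _ _ => permStarGraph_common_neighbor_unique) c₁ hp hp'
        hp'').exists_steinerPacking hk (Set.insert_nonempty _ _)
      simpa only [Set.image_insert_eq, Set.image_singleton] using this
    · exact exists_steinerPacking_of_two_clusters hk hp h13
  by_cases h13 : c₁ = c₃
  · subst h13
    have e : ({(c₁, p₁), (c₂, p₂), (c₁, p₃)} : Set (_ × _)) =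
        {(c₁, p₁), (c₁, p₃), (c₂, p₂)} := by rw [Set.pair_comm]
    rw [e]
    exact exists_steinerPacking_of_two_clusters hk (fun h => hxz (h ▸ rfl)) h12
  by_cases h23 : c₂ = c₃
  · subst h23
    have e : ({(c₁, p₁), (c₂, p₂), (c₂, p₃)} : Set (_ × _)) =
        {(c₂, p₂), (c₂, p₃), (c₁, p₁)} := by
      rw [Set.insert_comm, Set.pair_comm]
    rw [e]
    exact exists_steinerPacking_of_two_clusters hk (fun h => hyz (h ▸ rfl)) (Ne.symm h12)
  have hc : Function.Injective ![c₁, c₂, c₃] := by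
    intro i j hij
    fin_cases i <;> fin_cases j <;> simp_all
  have e : (Set.range fun s => (![c₁, c₂, c₃] s, ![p₁, p₂, p₃] s)) =
      {(c₁, p₁), (c₂, p₂), (c₃, p₃)} := by
    ext v
    simp [Fin.exists_fin_succ, eq_comm]
  exact e ▸ exists_steinerPacking_of_distinct_clusters hk hc ![p₁, p₂, p₃]

theorem corollary4p1 (n : ℕ) (hn : 2 ≤ n) :
    generalizedConnectivity 3 (hierarchicalStarGraph n) = ((n - 1 : ℕ) : ℕ∞) := by
  obtain ⟨k, rfl⟩ : ∃ k, n = k + 1 := ⟨n - 1, by omega⟩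
  have hk : 0 < k := by omega
  rw [Nat.add_sub_cancel]
  refine le_antisymm (generalizedConnectivity_hierarchicalStarGraph_le hk) (le_iInf ?_)
  rintro ⟨S, hS⟩
  obtain ⟨x, y, z, hxy, hxz, hyz, rfl⟩ := Finset.card_eq_three.mp hS
  obtain ⟨W, F, h⟩ := exists_steinerPacking_hierarchicalStarGraph hk hxy hxz hyz
  obtain ⟨T, hT⟩ := h.exists_trees (Set.insert_nonempty _ _)
  refine le_sSup ⟨k, T, ?_, rfl⟩
  simpa using hT
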